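/- Throughout, $\log$ is the binary logarithm and $0\log 0=0$. Let $m\ge 2$, let $|e_1\rangle,\dots,|e_m\rangle$ be an orthonormal basis of an $m$-dimensional complex Hilbert space $\mathcal H$, and put $|e_0\rangle=\frac1{\sqrt m}\sum_{j=1}^m|e_j\rangle$. The flat quantum pyramid is the ensemble $\mathcal E=\{\pi_j,\rho_j\}_{j=1,\dots,m}$ with $\pi_j=\frac1m$ and $\rho_j=|\psi_j\rangle\langle\psi_j|$, where $$|\psi_j\rangle=\sqrt{m r_1}\,|e_j\rangle+(\sqrt{r_0}-\sqrt{r_1})\,|e_0\rangle,\qquad r_0=0,\quad r_1=\frac1{m-1}.$$ An observable is a finite family $\mathcal M=\{M_k\}$ of positive operators on $\mathcal H$ with $\sum_kM_k=I$. With $p_{jk}=\pi_j\operatorname{Tr}\rho_jM_k$ and $p_k=\sum_jp_{jk}$, let $I(\mathcal E,\mathcal M)=\sum_{j,k}p_{jk}\log\frac{p_{jk}}{\pi_jp_k}$ and let $A(\mathcal E)=\sup_{\mathcal M}I(\mathcal E,\mathcal M)$ be the accessible information; $\mathcal M$ is information-optimal if it maximizes $I(\mathcal E,\cdot)$ over all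 observables. For $1\le t<\infty$ consider the observable with the $m+\frac{m(m-1)}2$ components $$M_k=t^{-2}|\tilde e_k\rangle\langle\tilde e_k|\ (1\le k\le m),\qquad M_{rs}=\tfrac2m(1-t^{-2})\,|rs\rangle\langle rs|\ (1\le r<s\le m),$$ where $|\tilde e_k\rangle=|e_k\rangle+\frac{t-1}{\sqrt m}|e_0\rangle$ and $|rs\rangle=\frac1{\sqrt2}(|e_r\rangle-|e_s\rangle)$; for $t=\infty$ the components are the limits $M_k=\frac1m|e_0\rangle\langle e_0|$, $M_{rs}=\frac2m|rs\rangle\langle rs|$. Let $\bar\rho=\sum_j\pi_j\rho_j$, $M_j'=\bar\rho^{-1/2}(\pi_j\rho_j)\bar\rho^{-1/2}$ (with the generalized inverse $\bar\rho^{-1/2}$), and, for a density operator $\sigma$, $K(\sigma)=-\sum_jM_j'\log\operatorname{Tr}\sigma M_j'$, understood as a quadratic form $\psi\mapsto-\sum_j\langle\psi|M_j'|\psi\rangle\log\operatorname{Tr}\sigma M_j'$ with values in $(-\infty,+\infty]$, where $-\log0=+\infty$ and $0\cdot\infty=0$. The dual problem is to maximize $\operatorname{Tr}\bar\rho\Lambda$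 over the Hermitian operators $\Lambda$ with $\Lambda\le K(\sigma)$ for all density operators $\sigma$. Then the observable of the above family with $t=1$ is information-optimal for $\mathcal E$ if $m\ge7$, and the one with $t=\infty$ is information-optimal for $\mathcal E$ if $m\le6$. The dual problem has a solution, and for every solution $\Lambda_0$ $$A(\mathcal E)=\log m-\operatorname{Tr}\Lambda_0\bar\rho=\begin{cases}\log\frac m2,& m\le6,\\[2pt] \frac{m-2}m\log(m-1),& m\ge7.\end{cases}$$ -/

import Mathlib

namespace QInfo

noncomputable section

set_option linter.unusedSectionVars false

open InnerProductSpace Filter Topology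

variable {H : Type*} [NormedAddCommGroup H] [InnerProductSpace ℂ H] [FiniteDimensional ℂ H]

/-! ### States, ensembles, observables -/

/-- The operator `|v⟩⟨v|`. -/
def ketbra (v : H) : H →L[ℂ] H := rankOne ℂ v v

/-- The (real part of the) trace of an operator; all traces used below are real. -/
def tr (A : H →L[ℂ] H) : ℝ := (LinearMap.trace ℂ H (A : H →ₗ[ℂ] H)).re

/-- A density operator: positive with unit trace. -/
def IsState (ρ : H →L[ℂ] H) : Prop :=
  ρ.IsPositive ∧ LinearMap.trace ℂ H (ρ : H →ₗ[ℂ] H) = 1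

/-- A finite ensemble of quantum states. -/
structure Ensemble (H : Type*) [NormedAddCommGroup H] [InnerProductSpace ℂ H]
    [FiniteDimensional ℂ H] (ι : Type*) [Fintype ι] where
  prob : ι → ℝ
  state : ι → (H →L[ℂ] H)
  prob_nonneg : ∀ j, 0 ≤ prob j
  sum_prob : ∑ j, prob j = 1
  isState : ∀ j, IsState (state j)

/-- An observable with finitely many outcomes: a positive operator-valued resolution of the
identity. -/
structure Observable (H : Type*) [NormedAddCommGroup H] [InnerProductSpace ℂ H]
    [FiniteDimensional ℂ H] (κ : Type*) [Fintype κ] where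
  effect : κ → (H →L[ℂ] H)
  isPositive : ∀ k, (effect k).IsPositive
  sum_effect : ∑ k, effect k = 1

variable {ι κ : Type*} [Fintype ι] [Fintype κ]

/-- The joint distribution `p_{jk} = π_j Tr ρ_j M_k`. -/
def jointProb (E : Ensemble H ι) (M : Observable H κ) (j : ι) (k : κ) : ℝ :=
  E.prob j * tr (E.state j * M.effect k)

/-- The output distribution `p_k = ∑_j p_{jk}`. -/
def outProb (E : Ensemble H ι) (M : Observable H κ) (k : κ) : ℝ :=
  ∑ j, jointProb E M j k

/-- The Shannon mutual information (binary logarithm). A term with `p_{jk} = 0` is `0`, and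
`p_{jk} ≠ 0` forces `π_j ≠ 0` and `p_k ≠ 0`. -/
def mutualInfo (E : Ensemble H ι) (M : Observable H κ) : ℝ :=
  ∑ j, ∑ k, jointProb E M j k *
    Real.logb 2 (jointProb E M j k / (E.prob j * outProb E M k))

/-- The accessible information: the supremum of the mutual information over all observables with
finitely many outcomes. -/
def accessibleInfo (E : Ensemble H ι) : ℝ :=
  sSup {x : ℝ | ∃ (n : ℕ) (N : Observable H (Fin n)), mutualInfo E N = x}

/-- An observable is information-optimal when no observable gives a larger mutual information. -/
def IsInfoOptimal (E : Ensemble H ι) (M : Observable H κ) : Prop :=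
  ∀ (n : ℕ) (N : Observable H (Fin n)), mutualInfo E N ≤ mutualInfo E M

/-- The average state `∑_j π_j ρ_j`. -/
def avgState (E : Ensemble H ι) : H →L[ℂ] H :=
  ∑ j, (E.prob j : ℂ) • E.state j

/-! ### The dual problem -/

/-- The generalized inverse square root of the average state: the function `x ↦ x^{-1/2}`, with
value `0` at `x = 0`, applied to the average state. -/
def avgInvSqrt [CompleteSpace H] (E : Ensemble H ι) : H →L[ℂ] H :=
  cfc (fun x : ℝ => (Real.sqrt x)⁻¹) (avgState E)

/-- The dual observable `M'_j = ρ̄^{-1/2} (π_j ρ_j) ρ̄^{-1/2}`. -/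
def dualEffect [CompleteSpace H] (E : Ensemble H ι) (j : ι) : H →L[ℂ] H :=
  avgInvSqrt E * ((E.prob j : ℂ) • E.state j) * avgInvSqrt E

/-- `-log₂ x` for `0 ≤ x`, with value `+∞` at `x = 0`. -/
def negLog (x : ℝ) : EReal :=
  if x ≤ 0 then ⊤ else ((-Real.logb 2 x : ℝ) : EReal)

/-- The quadratic form `⟨ψ|K(σ)|ψ⟩` of `K(σ) = -∑_j M'_j log Tr σ M'_j`. It may be `+∞`, and
`0 · ∞ = 0` (this is the convention of `EReal`). -/
def dualForm [CompleteSpace H] (E : Ensemble H ι) (σ : H →L[ℂ] H) (ψ : H) : EReal :=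
  ∑ j, (((inner ℂ ψ (dualEffect E j ψ)).re : ℝ) : EReal) * negLog (tr (σ * dualEffect E j))

/-- `Λ` is Hermitian and `Λ ≤ K(σ)` for all states `σ`. -/
def IsDualFeasible [CompleteSpace H] (E : Ensemble H ι) (Λ : H →L[ℂ] H) : Prop :=
  IsSelfAdjoint Λ ∧ ∀ σ : H →L[ℂ] H, IsState σ → ∀ ψ : H,
    (((inner ℂ ψ (Λ ψ)).re : ℝ) : EReal) ≤ dualForm E σ ψ

/-- `Λ` solves the dual problem: it maximizes `Tr ρ̄ Λ` over the feasible operators. -/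
def IsDualSolution [CompleteSpace H] (E : Ensemble H ι) (Λ : H →L[ℂ] H) : Prop :=
  IsDualFeasible E Λ ∧
    ∀ Λ' : H →L[ℂ] H, IsDualFeasible E Λ' → tr (avgState E * Λ') ≤ tr (avgState E * Λ)

/-! ### Quantum pyramids -/

variable {m : ℕ}

/-- `|e₀⟩ = m^{-1/2} ∑_j |e_j⟩`. -/
def e0 (b : OrthonormalBasis (Fin m) ℂ H) : H :=
  (((Real.sqrt m)⁻¹ : ℝ) : ℂ) • ∑ j, b j

/-- The pyramid vectors `|ψ_j⟩ = √(m r₁) |e_j⟩ + (√r₀ - √r₁) |e₀⟩`. -/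
def pyramidVec (b : OrthonormalBasis (Fin m) ℂ H) (r₀ r₁ : ℝ) (j : Fin m) : H :=
  ((Real.sqrt (m * r₁) : ℝ) : ℂ) • b j + ((Real.sqrt r₀ - Real.sqrt r₁ : ℝ) : ℂ) • e0 b


theorem inner_e0_basis (b : OrthonormalBasis (Fin m) ℂ H) (j : Fin m) :
    inner ℂ (e0 b) (b j) = (((Real.sqrt m)⁻¹ : ℝ) : ℂ) := by
  simp only [e0, inner_smul_left, sum_inner, Complex.conj_ofReal]
  simp [OrthonormalBasis.inner_eq_ite]

theorem inner_basis_e0 (b : OrthonormalBasis (Fin m) ℂ H) (j : Fin m) :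
    inner ℂ (b j) (e0 b) = (((Real.sqrt m)⁻¹ : ℝ) : ℂ) := by
  rw [← inner_conj_symm, inner_e0_basis, Complex.conj_ofReal]

theorem sum_basis (b : OrthonormalBasis (Fin m) ℂ H) (hm : 1 ≤ m) :
    ∑ j, b j = ((Real.sqrt m : ℝ) : ℂ) • e0 b := by
  have h : Real.sqrt m ≠ 0 := by
    have : (0 : ℝ) < m := by exact_mod_cast hm
    exact (Real.sqrt_pos.2 this).ne'
  rw [e0, smul_smul, ← Complex.ofReal_mul, mul_inv_cancel₀ h, Complex.ofReal_one, one_smul]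

theorem inner_e0_e0 (b : OrthonormalBasis (Fin m) ℂ H) (hm : 1 ≤ m) :
    inner ℂ (e0 b) (e0 b) = 1 := by
  have h : Real.sqrt m ≠ 0 := by
    have : (0 : ℝ) < m := by exact_mod_cast hm
    exact (Real.sqrt_pos.2 this).ne'
  have h2 : inner ℂ (e0 b) (∑ j, b j) = ((Real.sqrt m : ℝ) : ℂ) := by
    rw [inner_sum]
    simp only [inner_e0_basis]
    rw [Finset.sum_const, Finset.card_univ, Fintype.card_fin, nsmul_eq_mul]
    have h3 : (m : ℝ) * (Real.sqrt m)⁻¹ = Real.sqrt m := by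
      rw [mul_inv_eq_iff_eq_mul₀ h, Real.mul_self_sqrt (Nat.cast_nonneg m)]
    exact_mod_cast congrArg (fun x : ℝ => (x : ℂ)) h3
  rw [sum_basis b hm, inner_smul_right] at h2
  have h' : ((Real.sqrt m : ℝ) : ℂ) ≠ 0 := by exact_mod_cast h
  exact mul_left_cancel₀ h' (by rw [h2, mul_one])

theorem inner_pyramidVec_self (b : OrthonormalBasis (Fin m) ℂ H) (hm : 1 ≤ m) {r₀ r₁ : ℝ}
    (h₀ : 0 ≤ r₀) (h₁ : 0 ≤ r₁) (h : r₀ + (m - 1) * r₁ = 1) (j : Fin m) :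
    inner ℂ (pyramidVec b r₀ r₁ j) (pyramidVec b r₀ r₁ j) = 1 := by
  have hs : Real.sqrt m ≠ 0 := by
    have : (0 : ℝ) < m := by exact_mod_cast hm
    exact (Real.sqrt_pos.2 this).ne'
  simp only [pyramidVec, inner_add_left, inner_add_right, inner_smul_left, inner_smul_right,
    inner_e0_basis, inner_basis_e0, inner_e0_e0 b hm, Complex.conj_ofReal,
    OrthonormalBasis.inner_eq_ite, if_true, mul_one]
  have key : Real.sqrt (m * r₁) * Real.sqrt (m * r₁)
      + (Real.sqrt r₀ - Real.sqrt r₁) * (Real.sqrt (m * r₁) * (Real.sqrt m)⁻¹)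
      + (Real.sqrt (m * r₁) * ((Real.sqrt r₀ - Real.sqrt r₁) * (Real.sqrt m)⁻¹)
      + (Real.sqrt r₀ - Real.sqrt r₁) * (Real.sqrt r₀ - Real.sqrt r₁)) = 1 := by
    rw [Real.sqrt_mul (Nat.cast_nonneg m)]
    have a := Real.mul_self_sqrt (Nat.cast_nonneg (α := ℝ) m)
    have b0 := Real.mul_self_sqrt h₀
    have b1 := Real.mul_self_sqrt h₁
    have c : Real.sqrt m * (Real.sqrt m)⁻¹ = 1 := mul_inv_cancel₀ hs
    linear_combination (Real.sqrt r₁ * Real.sqrt r₁) * a + b0 + (m - 1) * b1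
      + 2 * (Real.sqrt r₀ - Real.sqrt r₁) * Real.sqrt r₁ * c + h
  have key' := congrArg (fun x : ℝ => (x : ℂ)) key
  push_cast at key' ⊢
  linear_combination key'

/-- The quantum pyramid: the ensemble of the states `|ψ_j⟩⟨ψ_j|` with equal probabilities,
where `r₀, r₁ ≥ 0` and `r₀ + (m - 1) r₁ = 1`. -/
def pyramid (b : OrthonormalBasis (Fin m) ℂ H) (hm : 1 ≤ m) (r₀ r₁ : ℝ)
    (h₀ : 0 ≤ r₀) (h₁ : 0 ≤ r₁) (h : r₀ + (m - 1) * r₁ = 1) : Ensemble H (Fin m) where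
  prob _ := 1 / m
  state j := ketbra (pyramidVec b r₀ r₁ j)
  prob_nonneg _ := by positivity
  sum_prob := by
    have : (m : ℝ) ≠ 0 := by exact_mod_cast (by omega : m ≠ 0)
    simp [this]
  isState j := ⟨isPositive_rankOne_self _, by
    rw [ketbra, trace_rankOne, inner_pyramidVec_self b hm h₀ h₁ h]⟩

/-- The flat pyramid: `r₀ = 0`, `r₁ = 1 / (m - 1)`. -/
def flatPyramid (b : OrthonormalBasis (Fin m) ℂ H) (hm : 2 ≤ m) : Ensemble H (Fin m) :=
  have h1 : (0 : ℝ) < m - 1 := by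
    have : (2 : ℝ) ≤ m := by exact_mod_cast hm
    linarith
  pyramid b (by omega) 0 (1 / (m - 1)) le_rfl (by positivity)
    (by rw [zero_add, mul_one_div_cancel h1.ne'])

/-! ### The family of observables -/

/-- The outcomes: `k = 1, …, m` and the pairs `r < s`. -/
abbrev Outcome (m : ℕ) : Type := Fin m ⊕ {p : Fin m × Fin m // p.1 < p.2}

/-- `|ẽ_k⟩ = |e_k⟩ + ((t - 1) / √m) |e₀⟩`. -/
def eTilde (b : OrthonormalBasis (Fin m) ℂ H) (t : ℝ) (k : Fin m) : H :=
  b k + (((t - 1) / Real.sqrt m : ℝ) : ℂ) • e0 b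

/-- `|rs⟩ = (|e_r⟩ - |e_s⟩) / √2`. -/
def pairVec (b : OrthonormalBasis (Fin m) ℂ H) (r s : Fin m) : H :=
  ((1 / Real.sqrt 2 : ℝ) : ℂ) • (b r - b s)

/-- The components `M_k = t^{-2} |ẽ_k⟩⟨ẽ_k|`, `M_{rs} = (2/m) (1 - t^{-2}) |rs⟩⟨rs|`. -/
def pyramidEffect (b : OrthonormalBasis (Fin m) ℂ H) (t : ℝ) : Outcome m → (H →L[ℂ] H)
  | .inl k => (((t ^ 2)⁻¹ : ℝ) : ℂ) • ketbra (eTilde b t k)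
  | .inr p => ((2 / m * (1 - (t ^ 2)⁻¹) : ℝ) : ℂ) • ketbra (pairVec b p.1.1 p.1.2)

/-- The components for `t = ∞`: `M_k = (1/m) |e₀⟩⟨e₀|`, `M_{rs} = (2/m) |rs⟩⟨rs|`. They are the
limits as `t → ∞` of the components for finite `t`, see `tendsto_pyramidEffect`. -/
def pyramidEffectTop (b : OrthonormalBasis (Fin m) ℂ H) : Outcome m → (H →L[ℂ] H)
  | .inl _ => ((1 / m : ℝ) : ℂ) • ketbra (e0 b)
  | .inr p => ((2 / m : ℝ) : ℂ) • ketbra (pairVec b p.1.1 p.1.2)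

theorem ketbra_smul (c : ℝ) (v : H) :
    ketbra ((c : ℂ) • v) = ((c ^ 2 : ℝ) : ℂ) • ketbra v := by
  ext x
  simp only [ketbra, rankOne_apply, inner_smul_left, smul_smul, Complex.conj_ofReal,
    _root_.smul_apply]
  congr 1
  push_cast
  ring

theorem continuous_ketbra : Continuous (ketbra : H → (H →L[ℂ] H)) := by
  rw [continuous_clm_apply]
  intro y
  simp only [ketbra, rankOne_apply]
  fun_prop

theorem tendsto_pyramidEffect (b : OrthonormalBasis (Fin m) ℂ H) (i : Outcome m) :
    Tendsto (fun t : ℝ => pyramidEffect b t i) atTop (𝓝 (pyramidEffectTop b i)) := by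
  have hinv : Tendsto (fun t : ℝ => t⁻¹) atTop (𝓝 0) := tendsto_inv_atTop_zero
  cases i with
  | inl k =>
    have h1 : ∀ᶠ t : ℝ in atTop, ketbra (((t⁻¹ : ℝ) : ℂ) • b k
        + (((1 - t⁻¹) / Real.sqrt m : ℝ) : ℂ) • e0 b) = pyramidEffect b t (.inl k) := by
      filter_upwards [eventually_gt_atTop 0] with t ht
      simp only [pyramidEffect]
      rw [← inv_pow, ← ketbra_smul, eTilde, smul_add, smul_smul, ← Complex.ofReal_mul]
      congr 5
      field_simp
    refine Tendsto.congr' h1 ?_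
    have h2 : Tendsto (fun t : ℝ => ((t⁻¹ : ℝ) : ℂ) • b k
        + (((1 - t⁻¹) / Real.sqrt m : ℝ) : ℂ) • e0 b) atTop
        (𝓝 (((0 : ℝ) : ℂ) • b k + (((1 - 0) / Real.sqrt m : ℝ) : ℂ) • e0 b)) := by
      refine Tendsto.add ?_ ?_
      · exact ((Complex.continuous_ofReal.tendsto _).comp hinv).smul_const _
      · exact ((Complex.continuous_ofReal.tendsto _).comp
          ((tendsto_const_nhds.sub hinv).div_const _)).smul_const _
    have h3 := (continuous_ketbra.tendsto _).comp h2
    have h4 : pyramidEffectTop b (.inl k) = ketbra (((0 : ℝ) : ℂ) • b k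
        + (((1 - 0) / Real.sqrt m : ℝ) : ℂ) • e0 b) := by
      rw [Complex.ofReal_zero, zero_smul, zero_add, ketbra_smul, div_pow,
        Real.sq_sqrt (Nat.cast_nonneg m), sub_zero, one_pow]
      rfl
    rw [h4]
    exact h3
  | inr p =>
    simp only [pyramidEffect, pyramidEffectTop]
    have h1 : Tendsto (fun t : ℝ => 2 / (m : ℝ) * (1 - (t ^ 2)⁻¹)) atTop (𝓝 (2 / m)) := by
      have h2 := (tendsto_const_nhds (x := (1 : ℝ))).sub (hinv.pow 2)
      have h3 := h2.const_mul (2 / (m : ℝ))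
      simpa using h3
    exact ((Complex.continuous_ofReal.tendsto _).comp h1).smul_const _

theorem sum_ketbra_basis (b : OrthonormalBasis (Fin m) ℂ H) : ∑ k, ketbra (b k) = 1 :=
  b.sum_rankOne_eq_id

theorem ketbra_add (u v : H) :
    ketbra (u + v) = ketbra u + rankOne ℂ u v + rankOne ℂ v u + ketbra v := by
  simp only [ketbra, map_add, _root_.add_apply]
  abel

theorem sum_ketbra_shift (b : OrthonormalBasis (Fin m) ℂ H) (hm : 1 ≤ m) (c : ℝ) :
    ∑ k, ketbra (b k + ((c / Real.sqrt m : ℝ) : ℂ) • e0 b)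
      = 1 + ((2 * c + c ^ 2 : ℝ) : ℂ) • ketbra (e0 b) := by
  have h : Real.sqrt m ≠ 0 := by
    have : (0 : ℝ) < m := by exact_mod_cast hm
    exact (Real.sqrt_pos.2 this).ne'
  have h' : ((Real.sqrt m : ℝ) : ℂ) ≠ 0 := by exact_mod_cast h
  have hsq : ((Real.sqrt m : ℝ) : ℂ) ^ 2 = m := by
    exact_mod_cast congrArg (fun x : ℝ => (x : ℂ)) (Real.sq_sqrt (Nat.cast_nonneg (α := ℝ) m))
  have h1 : ∀ v : H, ∑ k, rankOne ℂ (b k) v = rankOne ℂ (∑ k, b k) v := fun v => by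
    rw [map_sum, _root_.sum_apply]
  have h2 : ∀ v : H, ∑ k, rankOne ℂ v (b k) = rankOne ℂ v (∑ k, b k) := fun v => by
    rw [map_sum]
  simp only [ketbra_add, Finset.sum_add_distrib, sum_ketbra_basis, ← Finset.smul_sum, h1,
    h2, sum_basis b hm, ketbra_smul, Finset.sum_const, Finset.card_univ, Fintype.card_fin, map_smul, map_smulₛₗ,
    _root_.smul_apply, Complex.conj_ofReal, ← Nat.cast_smul_eq_nsmul ℂ]
  rw [show rankOne ℂ (e0 b) (e0 b) = ketbra (e0 b) from rfl]
  push_cast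
  match_scalars
  · ring
  · field_simp
    rw [hsq]
    ring

theorem ketbra_pairVec (b : OrthonormalBasis (Fin m) ℂ H) (r s : Fin m) :
    ketbra (pairVec b r s) = (2⁻¹ : ℂ) • (ketbra (b r) + ketbra (b s)
      - rankOne ℂ (b r) (b s) - rankOne ℂ (b s) (b r)) := by
  have h : ((1 / Real.sqrt 2) ^ 2 : ℝ) = 2⁻¹ := by
    rw [div_pow, Real.sq_sqrt zero_le_two, one_pow, one_div]
  rw [pairVec, ketbra_smul, h, Complex.ofReal_inv, Complex.ofReal_ofNat]
  congr 1
  simp only [ketbra, map_sub, _root_.sub_apply]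
  abel

theorem sum_lt_eq {V : Type*} [AddCommGroup V] [Module ℂ V] (f : Fin m → Fin m → V)
    (hs : ∀ r s, f r s = f s r) (hd : ∀ r, f r r = 0) :
    ∑ p : {p : Fin m × Fin m // p.1 < p.2}, f p.1.1 p.1.2
      = (2⁻¹ : ℂ) • ∑ r, ∑ s, f r s := by
  have h1 : ∑ p : {p : Fin m × Fin m // p.1 < p.2}, f p.1.1 p.1.2
      = ∑ r, ∑ s, if r < s then f r s else 0 := by
    rw [← Fintype.sum_prod_type' (f := fun r s => if r < s then f r s else 0),
      ← Finset.sum_filter]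
    exact (Finset.sum_subtype (Finset.univ.filter fun p : Fin m × Fin m => p.1 < p.2)
      (by simp) (fun p : Fin m × Fin m => f p.1 p.2)).symm
  have h2 : ∑ r, ∑ s, (if r < s then f r s else 0) = ∑ r, ∑ s, if s < r then f r s else 0 := by
    rw [Finset.sum_comm]
    exact Finset.sum_congr rfl fun r _ => Finset.sum_congr rfl fun s _ => by rw [hs s r]
  have h3 : ∑ r, ∑ s, f r s = (∑ r, ∑ s, if r < s then f r s else 0)
      + ∑ r, ∑ s, if s < r then f r s else 0 := by
    simp only [← Finset.sum_add_distrib]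
    refine Finset.sum_congr rfl fun r _ => Finset.sum_congr rfl fun s _ => ?_
    rcases lt_trichotomy r s with h | h | h
    · simp [h, h.not_gt]
    · simp [h, hd]
    · simp [h, h.not_gt]
  rw [h3, ← h2, ← h1]
  module

theorem sum_ketbra_pair (b : OrthonormalBasis (Fin m) ℂ H) (hm : 1 ≤ m) :
    ∑ p : {p : Fin m × Fin m // p.1 < p.2}, ketbra (pairVec b p.1.1 p.1.2)
      = ((m / 2 : ℝ) : ℂ) • (1 - ketbra (e0 b)) := by
  have hsq : ((Real.sqrt m : ℝ) : ℂ) ^ 2 = m := by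
    exact_mod_cast congrArg (fun x : ℝ => (x : ℂ)) (Real.sq_sqrt (Nat.cast_nonneg (α := ℝ) m))
  have h1 : ∀ v : H, ∑ k, rankOne ℂ (b k) v = rankOne ℂ (∑ k, b k) v := fun v => by
    rw [map_sum, _root_.sum_apply]
  have h2 : ∀ v : H, ∑ k, rankOne ℂ v (b k) = rankOne ℂ v (∑ k, b k) := fun v => by
    rw [map_sum]
  rw [sum_lt_eq (fun r s => ketbra (pairVec b r s))
    (fun r s => by rw [ketbra_pairVec, ketbra_pairVec]; module)
    (fun r => by rw [ketbra_pairVec]; simp only [ketbra]; module)]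
  simp only [ketbra_pairVec, ← Finset.smul_sum, Finset.sum_add_distrib, Finset.sum_sub_distrib,
    sum_ketbra_basis, h1, h2, sum_basis b hm, Finset.sum_const, Finset.card_univ,
    Fintype.card_fin, map_smul, map_smulₛₗ, _root_.smul_apply, Complex.conj_ofReal,
    ← Nat.cast_smul_eq_nsmul ℂ]
  rw [show rankOne ℂ (e0 b) (e0 b) = ketbra (e0 b) from rfl]
  push_cast
  match_scalars
  · ring
  · linear_combination (-1 / 2 : ℂ) * hsq

theorem sum_pyramidEffect (b : OrthonormalBasis (Fin m) ℂ H) (hm : 1 ≤ m) {t : ℝ}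
    (ht : 1 ≤ t) : ∑ i, pyramidEffect b t i = 1 := by
  have hm' : (m : ℂ) ≠ 0 := by exact_mod_cast (by omega : m ≠ 0)
  have ht' : (t : ℂ) ≠ 0 := by exact_mod_cast (by linarith : t ≠ 0)
  rw [Fintype.sum_sum_type]
  simp only [pyramidEffect, eTilde, ← Finset.smul_sum]
  rw [sum_ketbra_shift b hm, sum_ketbra_pair b hm]
  push_cast
  match_scalars <;> (field_simp; ring)

theorem sum_pyramidEffectTop (b : OrthonormalBasis (Fin m) ℂ H) (hm : 1 ≤ m) :
    ∑ i, pyramidEffectTop b i = 1 := by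
  have hm' : (m : ℂ) ≠ 0 := by exact_mod_cast (by omega : m ≠ 0)
  rw [Fintype.sum_sum_type]
  simp only [pyramidEffectTop, ← Finset.smul_sum]
  rw [sum_ketbra_pair b hm, Finset.sum_const, Finset.card_univ, Fintype.card_fin]
  push_cast
  rw [← Nat.cast_smul_eq_nsmul ℂ]
  match_scalars
  · field_simp
    norm_num
  · field_simp

theorem isPositive_smul_ketbra {c : ℝ} (hc : 0 ≤ c) (v : H) :
    ((c : ℂ) • ketbra v).IsPositive :=
  (isPositive_rankOne_self v).smul_of_nonneg (by exact_mod_cast hc)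

/-- The observable of the family with parameter `1 ≤ t < ∞`. -/
def pyramidObservable (b : OrthonormalBasis (Fin m) ℂ H) (hm : 1 ≤ m) (t : ℝ) (ht : 1 ≤ t) :
    Observable H (Outcome m) where
  effect := pyramidEffect b t
  isPositive i := by
    have h : (t ^ 2)⁻¹ ≤ 1 := inv_le_one_of_one_le₀ (by nlinarith)
    cases i with
    | inl k => exact isPositive_smul_ketbra (by positivity) _
    | inr p => exact isPositive_smul_ketbra (mul_nonneg (by positivity) (by linarith)) _
  sum_effect := sum_pyramidEffect b hm ht

/-- The observable of the family with parameter `t = ∞`. -/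
def pyramidObservableTop (b : OrthonormalBasis (Fin m) ℂ H) (hm : 1 ≤ m) :
    Observable H (Outcome m) where
  effect := pyramidEffectTop b
  isPositive i := by
    cases i with
    | inl k => exact isPositive_smul_ketbra (by positivity) _
    | inr p => exact isPositive_smul_ketbra (by positivity) _
  sum_effect := sum_pyramidEffectTop b hm

end

end QInfo

namespace QInfo

open Finset

/-! ### One-variable inequalities -/

/-! Put `c_j = e_j - m^{-1/2} e₀` (`centeredVec`). The `ψ_j` are multiples of the `c_j`, and `∑
|c_j⟩⟨c_j|` is the projection `P` onto the complement of `e₀`, so `ρ̄ = P/(m-1)` and `M'_j =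
|c_j⟩⟨c_j|`. An effect `|v⟩⟨v|` yields a posterior distribution proportional to `|z_j|²`, where `z_j
= ⟨c_j, v⟩` and `∑ z_j = 0`. Since the prior is uniform, the information is `log m` minus an average
of posterior entropies, and everything reduces to the least entropy `h` of `|z_j|²` over unit `z`
with `∑ z_j = 0`. The two competitors are the pair `(e_r - e_s)/√2`, with entropy `log 2`, and the
direction of `c_k`; the pair wins for `m ≤ 6`, `c_k` for `m ≥ 7`.

The lower bound for the entropy (`minEntropy_mul_sum_sq_le`) uses only the polygon inequality `|z_i|
≤ ∑_{j≠i} |z_j|`. With the largest amplitude scaled to 1, the other `n = m - 1` lie in `[0, 1]` and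
have sum at least 1. If all of them are small, tangents at `y_j = 1/n`, the shape of `c_k`, suffice
(`entropy_bound_of_all_le`). If one of them, `a`, is large, the pair `(1, a)` alone has entropy
close to `log 2`, and the loss `(1-a)²` is repaid by the other amplitudes or by the slack `log 2 -
h` (`entropy_bound_split`).

Combined with Gibbs' inequality (`minEntropy_mul_sum_norm_sq_le`), this bounds the information of
every observable and also makes `h P`, with `h` in bits, dual feasible. Minimizing vectors form a
tight frame of the range of `P`. The frame gives an observable attaining the bound, and testing a
feasible `Λ` on the frame gives `Tr ρ̄Λ ≤ h`. -/

theorem two_mul_log_le_sub_inv {s : ℝ} (hs : 1 ≤ s) : 2 * Real.log s ≤ s - s⁻¹ := by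
  have h := Real.self_le_sinh_iff.2 (Real.log_nonneg hs)
  rw [Real.sinh_log (by linarith)] at h
  linarith

/-- The second order Taylor remainder of `s ↦ s² log s` at `1`, divided by `(s - 1)²`, is
increasing. -/
theorem monotoneOn_taylor_quotient :
    MonotoneOn (fun s : ℝ => (2 * s ^ 2 * Real.log s - 2 * s + 2) / (s - 1) ^ 2)
      (Set.Ioi 1) := by
  have hd : ∀ s ∈ Set.Ioi (1 : ℝ),
      HasDerivAt (fun s : ℝ => (2 * s ^ 2 * Real.log s - 2 * s + 2) / (s - 1) ^ 2)
        (2 * s * (s - s⁻¹ - 2 * Real.log s) / (s - 1) ^ 3) s := by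
    intro s hs
    have h1 : (1 : ℝ) < s := hs
    have hs0 : s ≠ 0 := by linarith
    have hs1 : s - 1 ≠ 0 := by linarith
    have hlog := Real.hasDerivAt_log hs0
    have hnum := ((((hasDerivAt_id s).pow 2).const_mul 2).mul hlog).sub
      ((hasDerivAt_id s).const_mul 2) |>.add_const 2
    have hden := ((hasDerivAt_id s).sub_const 1).pow 2
    refine (hnum.div hden (by simpa using hs1)).congr_deriv ?_
    simp
    field_simp
    ring
  refine monotoneOn_of_hasDerivWithinAt_nonneg (convex_Ioi 1)
    (fun s hs => (hd s hs).continuousAt.continuousWithinAt)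
    (fun s hs => (hd s (interior_subset hs)).hasDerivWithinAt) fun s hs => ?_
  rw [interior_Ioi] at hs
  have h1 : (1 : ℝ) < s := hs
  have := two_mul_log_le_sub_inv h1.le
  have h2 : 0 ≤ s - s⁻¹ - 2 * Real.log s := by linarith
  have h3 : 0 < s - 1 := by linarith
  positivity

/-- The quotient of the remainder by `(s - 1)²` tends to 3 at `s = 1`, whence `3 ≤ w`. It increases
beyond 1, so the single check at `s₀` covers `(1, s₀]`. For `s ≤ 1` the constant 3 works, by `log (1
+ t) ≥ 2t / (t + 2)` at `t = s⁻¹ - 1`. -/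
theorem taylor_remainder_le {w s₀ s : ℝ} (hw : 3 ≤ w) (h₀ : 1 < s₀)
    (h : 2 * s₀ ^ 2 * Real.log s₀ - 2 * s₀ + 2 ≤ w * (s₀ - 1) ^ 2) (hs : 0 ≤ s) (hs₀ : s ≤ s₀) :
    2 * s ^ 2 * Real.log s - 2 * s + 2 ≤ w * (s - 1) ^ 2 := by
  rcases le_or_gt s 1 with h1 | h1
  · rcases hs.eq_or_lt with rfl | hpos
    · norm_num; linarith
    · have ht : 0 ≤ s⁻¹ - 1 := by
        have := (one_le_inv₀ hpos).2 h1
        linarith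
      have hl := Real.le_log_one_add_of_nonneg ht
      rw [add_sub_cancel, Real.log_inv] at hl
      have h2 : 2 * (s⁻¹ - 1) / (s⁻¹ - 1 + 2) = 2 * (1 - s) / (1 + s) := by
        field_simp
        ring
      rw [h2] at hl
      have h3 : s ^ 2 * (2 * (1 - s) / (1 + s)) ≤ s ^ 2 * (-Real.log s) :=
        mul_le_mul_of_nonneg_left hl (sq_nonneg s)
      have h4 : (1 - s) * (3 * s - 1) ≤ 2 * (s ^ 2 * (2 * (1 - s) / (1 + s))) := by
        rw [mul_div_assoc', mul_div_assoc', le_div_iff₀ (by linarith)]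
        nlinarith [pow_nonneg (sub_nonneg.2 h1) 3, pow_nonneg (sub_nonneg.2 h1) 2]
      nlinarith [sq_nonneg (s - 1)]
  · have h2 := monotoneOn_taylor_quotient (Set.mem_Ioi.2 h1) (Set.mem_Ioi.2 h₀) hs₀
    have h3 : (2 * s₀ ^ 2 * Real.log s₀ - 2 * s₀ + 2) / (s₀ - 1) ^ 2 ≤ w :=
      (div_le_iff₀ (by nlinarith)).2 h
    exact (div_le_iff₀ (by nlinarith)).1 (h2.trans h3)

/-- The tangent at `b` of `y ↦ y² (κ - 2 log y)` lies below the function on `[0, a]`. -/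
theorem tangent_le {κ w a b y : ℝ} (hb : 0 < b) (hw : 3 ≤ w) (hκ : w = κ - 2 * Real.log b)
    (hab : b < a)
    (h : 2 * (a / b) ^ 2 * Real.log (a / b) - 2 * (a / b) + 2 ≤ w * (a / b - 1) ^ 2)
    (hy : 0 ≤ y) (hya : y ≤ a) :
    2 * b * (w - 1) * y - b ^ 2 * (w - 2) ≤ y ^ 2 * (κ - 2 * Real.log y) := by
  -- With `s = y / b`, the function minus its tangent is `b² (w (s - 1)² - (2 s² log s - 2 s + 2))`.
  have h1 := taylor_remainder_le (s := y / b) hw ((one_lt_div hb).2 hab) h (by positivity)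
    (by gcongr)
  rcases hy.eq_or_lt with rfl | hpos
  · norm_num
    nlinarith [sq_nonneg b]
  · rw [Real.log_div hpos.ne' hb.ne'] at h1
    have h2 := mul_le_mul_of_nonneg_left h1 (sq_nonneg b)
    have h3 : b ^ 2 * (2 * (y / b) ^ 2 * (Real.log y - Real.log b) - 2 * (y / b) + 2)
        = 2 * y ^ 2 * (Real.log y - Real.log b) - 2 * b * y + 2 * b ^ 2 := by
      field_simp
    have h4 : b ^ 2 * (w * (y / b - 1) ^ 2) = w * (y - b) ^ 2 := by
      field_simp
    rw [h3, h4] at h2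
    have h5 : Real.log b = (κ - w) / 2 := by linarith
    rw [h5] at h2
    nlinarith

/-- A quadratic lower bound for the binary entropy, in homogeneous form. -/
theorem binary_entropy_lower_bound {a : ℝ} (ha : 0 < a) (ha1 : a ≤ 1) :
    (1 + a ^ 2) * Real.log 2 - (1 - a) ^ 2
      ≤ (1 + a ^ 2) * Real.log (1 + a ^ 2) - a ^ 2 * (2 * Real.log a) := by
  -- The difference `D` of the two sides, defined below, has derivative `2 x E x`. Since `E`
  -- increases to `E 1 = 0`, `D` decreases on `(0, 1]` to `D 1 = 0`.
  set E : ℝ → ℝ := fun x => 1 - x⁻¹ - Real.log 2 + Real.log (1 + x ^ 2) - 2 * Real.log x with hE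
  have hlog : ∀ x : ℝ, HasDerivAt (fun x : ℝ => Real.log (1 + x ^ 2)) (2 * x / (1 + x ^ 2)) x := by
    intro x
    have h1 : HasDerivAt (fun x : ℝ => 1 + x ^ 2) (2 * x) x := by
      simpa using (hasDerivAt_pow 2 x).const_add 1
    exact h1.log (by positivity)
  have hEd : ∀ x ∈ Set.Ioi (0 : ℝ),
      HasDerivAt E ((1 - x) ^ 2 / (x ^ 2 * (1 + x ^ 2))) x := by
    intro x hx
    have hx0 : x ≠ 0 := (Set.mem_Ioi.1 hx).ne'
    have h := ((((hasDerivAt_inv hx0).const_sub 1).sub_const (Real.log 2)).add (hlog x)).sub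
      ((Real.hasDerivAt_log hx0).const_mul 2)
    refine h.congr_deriv ?_
    have : 1 + x ^ 2 ≠ 0 := by positivity
    field_simp
    ring
  have hEmono : MonotoneOn E (Set.Ioi 0) := by
    refine monotoneOn_of_hasDerivWithinAt_nonneg (convex_Ioi 0)
      (fun s hs => (hEd s hs).continuousAt.continuousWithinAt)
      (fun s hs => (hEd s (interior_subset hs)).hasDerivWithinAt) fun s hs => by positivity
  have hE1 : E 1 = 0 := by
    simp only [hE]
    norm_num
  set D : ℝ → ℝ := fun x => (1 - x) ^ 2 - (1 + x ^ 2) * Real.log 2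
    + (1 + x ^ 2) * Real.log (1 + x ^ 2) - x ^ 2 * (2 * Real.log x) with hD
  have hDd : ∀ x ∈ Set.Ioi (0 : ℝ), HasDerivAt D (2 * x * E x) x := by
    intro x hx
    have hx0 : x ≠ 0 := (Set.mem_Ioi.1 hx).ne'
    have hsq : HasDerivAt (fun x : ℝ => x ^ 2) (2 * x) x := by
      simpa using hasDerivAt_pow 2 x
    have h1 : HasDerivAt (fun x : ℝ => 1 + x ^ 2) (2 * x) x := hsq.const_add 1
    have h2 : HasDerivAt (fun x : ℝ => (1 - x) ^ 2) (-(2 * (1 - x))) x := by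
      simpa using ((hasDerivAt_id x).const_sub 1).fun_pow 2
    have h := ((h2.sub (h1.mul_const (Real.log 2))).add (h1.mul (hlog x))).sub
      (hsq.mul ((Real.hasDerivAt_log hx0).const_mul 2))
    refine h.congr_deriv ?_
    have : 1 + x ^ 2 ≠ 0 := by positivity
    simp only [hE]
    field_simp
    ring
  have hDanti : AntitoneOn D (Set.Ioc 0 1) := by
    refine antitoneOn_of_hasDerivWithinAt_nonpos (convex_Ioc 0 1)
      (fun s hs => (hDd s hs.1).continuousAt.continuousWithinAt)
      (fun s hs => (hDd s (interior_subset hs).1).hasDerivWithinAt) fun s hs => ?_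
    have hs' := interior_subset hs
    have h1 : E s ≤ 0 := hE1 ▸ hEmono hs'.1 (Set.mem_Ioi.2 one_pos) hs'.2
    have h2 : 0 < s := hs'.1
    nlinarith
  have h1 : D 1 ≤ D a := hDanti ⟨ha, ha1⟩ ⟨one_pos, le_rfl⟩ ha1
  have h2 : D 1 = 0 := by
    simp only [hD]
    norm_num
  rw [h2] at h1
  simp only [hD] at h1
  linarith

/-- The tangent of `x ↦ x log x` at `q`. -/
theorem mul_log_tangent_le {x q : ℝ} (hx : 0 < x) (hq : 0 < q) :
    x * (Real.log q + 1) - q ≤ x * Real.log x := by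
  have h := Real.log_le_sub_one_of_pos (div_pos hq hx)
  rw [Real.log_div hq.ne' hx.ne'] at h
  have h2 := mul_le_mul_of_nonneg_left h hx.le
  have h3 : x * (q / x - 1) = q - x := by field_simp
  rw [h3] at h2
  linarith

/-! ### The entropy inequality for amplitudes with the largest one normalized to `1` -/

section Normalized

variable {ι : Type*} {s : Finset ι} {y : ι → ℝ}

/-- The tangents of `y² (1 - 2L - 2 log y)` at `1/n` and of `x log x` at `1 + 1/n` are both exact at
`y_j = 1/n`, so the constant is the entropy of `c_k` for `m = n + 1`. The first tangent has
nonnegative slope and nonpositive intercept; hence a sum of at least 1 and at most `n` terms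
suffice. -/
theorem entropy_bound_of_all_le {n : ℕ} {a L : ℝ} (hn : 0 < n) (hcard : s.card ≤ n)
    (hL : Real.log n = (n + 1) * L) (hw : 3 ≤ 1 + 2 * n * L) (han : 1 < a * n)
    (h : 2 * (a * n) ^ 2 * Real.log (a * n) - 2 * (a * n) + 2
      ≤ (1 + 2 * n * L) * (a * n - 1) ^ 2)
    (hy : ∀ j ∈ s, 0 ≤ y j) (hya : ∀ j ∈ s, y j ≤ a) (hsum : 1 ≤ ∑ j ∈ s, y j) :
    (Real.log (1 + 1 / n) + 2 * L) * (1 + ∑ j ∈ s, y j ^ 2)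
      ≤ (1 + ∑ j ∈ s, y j ^ 2) * Real.log (1 + ∑ j ∈ s, y j ^ 2)
        - ∑ j ∈ s, y j ^ 2 * (2 * Real.log (y j)) := by
  have hn' : (0 : ℝ) < n := by exact_mod_cast hn
  set w := 1 + 2 * n * L with hwdef
  have hb : (0 : ℝ) < 1 / n := by positivity
  have hdiv : a / (1 / n) = a * n := by field_simp
  have htan : ∀ j ∈ s, 2 * (1 / n) * (w - 1) * y j - (1 / n : ℝ) ^ 2 * (w - 2)
      ≤ y j ^ 2 * ((1 - 2 * L) - 2 * Real.log (y j)) := fun j hj => by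
    refine tangent_le (a := a) hb hw ?_ ?_ ?_ (hy j hj) (hya j hj)
    · rw [one_div, Real.log_inv, hL]
      ring
    · rw [div_lt_iff₀ hn']
      exact han
    · rw [hdiv]
      exact h
  have h1 := sum_le_sum htan
  rw [sum_sub_distrib, ← mul_sum, sum_const, nsmul_eq_mul] at h1
  have hcard' : (s.card : ℝ) ≤ n := by exact_mod_cast hcard
  have h2 : (s.card : ℝ) * ((1 / n : ℝ) ^ 2 * (w - 2)) ≤ n * ((1 / n : ℝ) ^ 2 * (w - 2)) :=
    mul_le_mul_of_nonneg_right hcard' (mul_nonneg (by positivity) (by linarith))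
  have h3 : 2 * (1 / n) * (w - 1) * 1 ≤ 2 * (1 / n) * (w - 1) * ∑ j ∈ s, y j :=
    mul_le_mul_of_nonneg_left hsum (mul_nonneg (by positivity) (by linarith))
  have h4 : 2 * (1 / n) * (w - 1) * 1 - n * ((1 / n : ℝ) ^ 2 * (w - 2)) = 1 / n + 2 * L := by
    rw [hwdef]
    field_simp
    ring
  have h5 : ∑ j ∈ s, y j ^ 2 * ((1 - 2 * L) - 2 * Real.log (y j))
      = (1 - 2 * L) * ∑ j ∈ s, y j ^ 2 - ∑ j ∈ s, y j ^ 2 * (2 * Real.log (y j)) := by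
    rw [mul_sum, ← sum_sub_distrib]
    exact sum_congr rfl fun j _ => by ring
  have hS : 0 ≤ ∑ j ∈ s, y j ^ 2 := sum_nonneg fun j _ => sq_nonneg _
  have h6 := mul_log_tangent_le (x := 1 + ∑ j ∈ s, y j ^ 2) (q := 1 + 1 / n) (by linarith)
    (by positivity)
  linarith

/-- The tangent of `x log x` at `1 + a²` isolates the pair of amplitudes `1, a`, whose entropy is at
least `log 2` up to the loss `(1 - a)²`. The hypothesis `hrest` says that the slack `log 2 - c` and
the remaining amplitudes repay this loss. -/
theorem entropy_bound_split [DecidableEq ι] {c a : ℝ} {i : ι} (hi : i ∈ s) (hyi : y i = a)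
    (ha : 0 < a) (ha1 : a ≤ 1)
    (hrest : (1 - a) ^ 2 ≤ (1 + a ^ 2) * (Real.log 2 - c) +
      ∑ j ∈ s.erase i, y j ^ 2 * (Real.log (1 + a ^ 2) + 1 - c - 2 * Real.log (y j))) :
    c * (1 + ∑ j ∈ s, y j ^ 2)
      ≤ (1 + ∑ j ∈ s, y j ^ 2) * Real.log (1 + ∑ j ∈ s, y j ^ 2)
        - ∑ j ∈ s, y j ^ 2 * (2 * Real.log (y j)) := by
  have hS : 0 ≤ ∑ j ∈ s, y j ^ 2 := sum_nonneg fun j _ => sq_nonneg _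
  have h1 := mul_log_tangent_le (x := 1 + ∑ j ∈ s, y j ^ 2) (q := 1 + a ^ 2) (by linarith)
    (by positivity)
  have h2 := binary_entropy_lower_bound ha ha1
  have h3 : ∑ j ∈ s.erase i, y j ^ 2 * (Real.log (1 + a ^ 2) + 1 - c - 2 * Real.log (y j))
      = (Real.log (1 + a ^ 2) + 1 - c) * ∑ j ∈ s.erase i, y j ^ 2
        - ∑ j ∈ s.erase i, y j ^ 2 * (2 * Real.log (y j)) := by
    rw [mul_sum, ← sum_sub_distrib]
    exact sum_congr rfl fun j _ => by ring
  have h4 := add_sum_erase s (fun j => y j ^ 2) hi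
  have h5 := add_sum_erase s (fun j => y j ^ 2 * (2 * Real.log (y j))) hi
  simp only [hyi] at h4 h5
  rw [← h5]
  rw [h3] at hrest
  rw [← h4] at h1 ⊢
  linarith

/-- The polygon inequality leaves the remaining amplitudes a sum of at least `r = 1 - a`. Each
summand is at least `y_j²`, because `y_j² ≤ a² ≤ (1 + a²)/2`; so one amplitude above `r` is enough.
Otherwise rescaling by `r` brings back the tangent argument at `1/N`, which yields `r² W / N`. -/
theorem sq_le_sum_rest {κ a W : ℝ} {N : ℕ} (hN : 2 ≤ N) (hcard : s.card ≤ N) (ha0 : 0 ≤ a)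
    (ha1 : a ≤ 1) (hκ : Real.log (1 + a ^ 2) + 1 - Real.log 2 ≤ κ) (hW3 : 3 ≤ W)
    (hWN : (N : ℝ) ≤ W)
    (hgap : 2 * (N : ℝ) ^ 2 * Real.log N - 2 * N + 2 ≤ W * (N - 1) ^ 2)
    (hW : Real.exp (W - 1) * (2 * (1 - a) ^ 2) ≤ (1 + a ^ 2) * N ^ 2)
    (hy : ∀ j ∈ s, 0 ≤ y j) (hya : ∀ j ∈ s, y j ≤ a) (hsum : 1 - a ≤ ∑ j ∈ s, y j) :
    (1 - a) ^ 2 ≤ ∑ j ∈ s, y j ^ 2 * (κ - 2 * Real.log (y j)) := by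
  have hN' : (0 : ℝ) < N := by exact_mod_cast (by omega : 0 < N)
  have hN1 : (1 : ℝ) < N := by exact_mod_cast (by omega : 1 < N)
  have hsq : ∀ j ∈ s, y j ^ 2 ≤ y j ^ 2 * (κ - 2 * Real.log (y j)) := fun j hj => by
    rcases (hy j hj).eq_or_lt with h0 | hpos
    · rw [← h0]
      norm_num
    · have h1 : y j ^ 2 ≤ (1 + a ^ 2) / 2 := by
        have := pow_le_pow_left₀ hpos.le (hya j hj) 2
        nlinarith
      have h2 := Real.log_le_log (by positivity) h1
      rw [Real.log_pow, Real.log_div (by positivity) two_ne_zero] at h2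
      push_cast at h2
      have h3 : 1 ≤ κ - 2 * Real.log (y j) := by linarith
      nlinarith [sq_nonneg (y j)]
  have hnn : ∀ j ∈ s, 0 ≤ y j ^ 2 * (κ - 2 * Real.log (y j)) := fun j hj =>
    (sq_nonneg _).trans (hsq j hj)
  by_cases hbig : ∃ j ∈ s, 1 - a ≤ y j
  · obtain ⟨j, hj, hle⟩ := hbig
    calc (1 - a) ^ 2 ≤ y j ^ 2 := pow_le_pow_left₀ (by linarith) hle 2
      _ ≤ _ := hsq j hj
      _ ≤ _ := single_le_sum hnn hj
  push Not at hbig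
  set r := 1 - a with hr
  rcases (sub_nonneg.2 ha1).eq_or_lt with h0 | hrpos
  · rw [← hr] at h0
    rw [← h0]
    simpa using sum_nonneg hnn
  rw [← hr] at hrpos
  set k := W - 2 * Real.log N with hk
  -- This is the logarithm of `hW`.
  have hkle : k ≤ κ - 2 * Real.log r := by
    have h1 : Real.exp (W - 1) ≤ (1 + a ^ 2) * N ^ 2 / (2 * r ^ 2) := by
      rwa [le_div_iff₀ (by positivity)]
    have h2 := (Real.le_log_iff_exp_le (by positivity)).2 h1
    rw [Real.log_div (by positivity) (by positivity), Real.log_mul (by positivity) (by positivity),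
      Real.log_mul (by positivity) (by positivity), Real.log_pow, Real.log_pow] at h2
    push_cast at h2
    linarith
  have hterm : ∀ j ∈ s, r ^ 2 * (2 * (1 / N) * (W - 1) * (y j / r) - (1 / N : ℝ) ^ 2 * (W - 2))
      ≤ y j ^ 2 * (κ - 2 * Real.log (y j)) := fun j hj => by
    have hdiv : (1 : ℝ) / (1 / N) = N := by field_simp
    have h1 := tangent_le (κ := k) (w := W) (a := 1) (b := 1 / N) (y := y j / r) (by positivity)
      hW3 (by rw [one_div, Real.log_inv]; simp only [hk]; ring)
      (by rw [div_lt_iff₀ hN']; linarith) (by rw [hdiv]; exact hgap)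
      (div_nonneg (hy j hj) hrpos.le) ((div_le_one hrpos).2 (hbig j hj).le)
    refine (mul_le_mul_of_nonneg_left h1 (sq_nonneg r)).trans ?_
    rcases (hy j hj).eq_or_lt with h0 | hpos
    · rw [← h0]
      norm_num
    · rw [Real.log_div hpos.ne' hrpos.ne', ← mul_assoc, ← mul_pow, mul_div_cancel₀ _ hrpos.ne']
      exact mul_le_mul_of_nonneg_left (by linarith) (sq_nonneg _)
  refine le_trans ?_ (sum_le_sum hterm)
  rw [← mul_sum, sum_sub_distrib, ← mul_sum, ← sum_div, sum_const, nsmul_eq_mul]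
  have hcard' : (s.card : ℝ) ≤ N := by exact_mod_cast hcard
  have h2 : (s.card : ℝ) * ((1 / N : ℝ) ^ 2 * (W - 2)) ≤ N * ((1 / N : ℝ) ^ 2 * (W - 2)) :=
    mul_le_mul_of_nonneg_right hcard' (mul_nonneg (by positivity) (by linarith))
  have h3 : 2 * (1 / N) * (W - 1) * 1 ≤ 2 * (1 / N) * (W - 1) * ((∑ j ∈ s, y j) / r) :=
    mul_le_mul_of_nonneg_left ((one_le_div hrpos).2 hsum)
      (mul_nonneg (by positivity) (by linarith))
  have h4 : 2 * (1 / N) * (W - 1) * 1 - N * ((1 / N : ℝ) ^ 2 * (W - 2)) = W / N := by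
    field_simp
    ring
  have h5 : 1 ≤ W / N := (one_le_div hN').2 hWN
  nlinarith [sq_nonneg r]

/-- The two regimes combined: `a₀` separates small second amplitudes from large ones. -/
theorem entropy_bound_of_few {n : ℕ} {a₀ c L W : ℝ} (hn : 3 ≤ n) (hcard : s.card ≤ n)
    (ha₀ : 0 < a₀) (hc : c ≤ Real.log (1 + 1 / n) + 2 * L) (hc2 : c ≤ Real.log 2)
    (hL : Real.log n = (n + 1) * L) (hw : 3 ≤ 1 + 2 * n * L) (han : 1 < a₀ * n)
    (h : 2 * (a₀ * n) ^ 2 * Real.log (a₀ * n) - 2 * (a₀ * n) + 2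
      ≤ (1 + 2 * n * L) * (a₀ * n - 1) ^ 2)
    (hW3 : 3 ≤ W) (hWN : (n : ℝ) - 1 ≤ W)
    (hgap : 2 * ((n : ℝ) - 1) ^ 2 * Real.log (n - 1) - 2 * (n - 1) + 2
      ≤ W * ((n : ℝ) - 1 - 1) ^ 2)
    (hW : Real.exp (W - 1) * (2 * (1 - a₀) ^ 2) ≤ (1 + a₀ ^ 2) * ((n : ℝ) - 1) ^ 2)
    (hy : ∀ j ∈ s, 0 ≤ y j) (hy1 : ∀ j ∈ s, y j ≤ 1) (hsum : 1 ≤ ∑ j ∈ s, y j) :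
    c * (1 + ∑ j ∈ s, y j ^ 2)
      ≤ (1 + ∑ j ∈ s, y j ^ 2) * Real.log (1 + ∑ j ∈ s, y j ^ 2)
        - ∑ j ∈ s, y j ^ 2 * (2 * Real.log (y j)) := by
  classical
  have hS : 0 ≤ ∑ j ∈ s, y j ^ 2 := sum_nonneg fun j _ => sq_nonneg _
  by_cases hall : ∀ j ∈ s, y j ≤ a₀
  · refine le_trans ?_ (entropy_bound_of_all_le (by omega) hcard hL hw han h hy hall hsum)
    exact mul_le_mul_of_nonneg_right hc (by linarith)
  push Not at hall
  obtain ⟨j₀, hj₀, hlt⟩ := hall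
  obtain ⟨i, hi, hmax⟩ := exists_max_image s y ⟨j₀, hj₀⟩
  have hai : a₀ < y i := hlt.trans_le (hmax j₀ hj₀)
  have h1 := add_sum_erase s y hi
  have hcast : ((n - 1 : ℕ) : ℝ) = n - 1 := by
    rw [Nat.cast_sub (by omega)]
    norm_num
  refine entropy_bound_split hi rfl (ha₀.trans hai) (hy1 i hi) ?_
  have h2 := sq_le_sum_rest (s := s.erase i) (y := y) (κ := Real.log (1 + y i ^ 2) + 1 - c)
    (a := y i) (W := W) (N := n - 1) (by omega) (by rw [card_erase_of_mem hi]; omega)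
    (hy i hi) (hy1 i hi) (by linarith) hW3 (by rwa [hcast]) (by rwa [hcast])
    (by
      rw [hcast]
      -- The left side of `hW` decreases and the right side increases with the amplitude, so the
      -- check at `a₀` covers `y i`.
      refine le_trans ?_ (hW.trans ?_)
      · have : 1 - y i ≤ 1 - a₀ := by linarith
        have h0 : 0 ≤ 1 - y i := by linarith [hy1 i hi]
        gcongr
      · gcongr)
    (fun j hj => hy j (mem_of_mem_erase hj)) (fun j hj => hmax j (mem_of_mem_erase hj))
    (by linarith)
  have h3 : 0 ≤ (1 + y i ^ 2) * (Real.log 2 - c) :=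
    mul_nonneg (by positivity) (by linarith)
  linarith

/-- Here the slack `(1 + a²) (log 2 - c)` alone repays the loss `(1 - a)²`, and the other summands
need only be nonnegative. -/
theorem entropy_bound_of_many {n : ℕ} {a₀ c L : ℝ} (hn : 0 < n) (hcard : s.card ≤ n)
    (ha₀ : 0 < a₀) (hc : c = Real.log (1 + 1 / n) + 2 * L) (hc2 : c ≤ Real.log 2)
    (hL : Real.log n = (n + 1) * L) (hw : 3 ≤ 1 + 2 * n * L) (han : 1 < a₀ * n)
    (h : 2 * (a₀ * n) ^ 2 * Real.log (a₀ * n) - 2 * (a₀ * n) + 2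
      ≤ (1 + 2 * n * L) * (a₀ * n - 1) ^ 2)
    (hgap : (1 - a₀) ^ 2 ≤ (1 + a₀ ^ 2) * (Real.log 2 - c))
    (hy : ∀ j ∈ s, 0 ≤ y j) (hy1 : ∀ j ∈ s, y j ≤ 1) (hsum : 1 ≤ ∑ j ∈ s, y j) :
    c * (1 + ∑ j ∈ s, y j ^ 2)
      ≤ (1 + ∑ j ∈ s, y j ^ 2) * Real.log (1 + ∑ j ∈ s, y j ^ 2)
        - ∑ j ∈ s, y j ^ 2 * (2 * Real.log (y j)) := by
  classical
  by_cases hall : ∀ j ∈ s, y j ≤ a₀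
  · rw [hc]
    exact entropy_bound_of_all_le hn hcard hL hw han h hy hall hsum
  push Not at hall
  obtain ⟨i, hi, hai⟩ := hall
  refine entropy_bound_split hi rfl (ha₀.trans hai) (hy1 i hi) ?_
  have h1 : (1 - y i) ^ 2 ≤ (1 - a₀) ^ 2 :=
    pow_le_pow_left₀ (by linarith [hy1 i hi]) (by linarith) 2
  have h2 : (1 + a₀ ^ 2) * (Real.log 2 - c) ≤ (1 + y i ^ 2) * (Real.log 2 - c) := by
    have : 0 ≤ Real.log 2 - c := by linarith
    gcongr
  have h3 : 0 ≤ ∑ j ∈ s.erase i,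
      y j ^ 2 * (Real.log (1 + y i ^ 2) + 1 - c - 2 * Real.log (y j)) := by
    refine sum_nonneg fun j hj => mul_nonneg (sq_nonneg _) ?_
    have hj' := mem_of_mem_erase hj
    have h4 := Real.log_nonpos (hy j hj') (hy1 j hj')
    have h5 : 0 ≤ Real.log (1 + y i ^ 2) := Real.log_nonneg (by nlinarith [sq_nonneg (y i)])
    linarith [Real.log_two_lt_d9]
  linarith

end Normalized

/-- The minimal entropy (in nats) of a unit vector orthogonal to `e₀`. -/
noncomputable def minEntropy (m : ℕ) : ℝ :=
  if m ≤ 6 then Real.log 2 else Real.log m - ((m : ℝ) - 2) / m * Real.log ((m : ℝ) - 1)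

/-! ### Numerical verification in each dimension -/

theorem log_seven_lower : 1.9365 < Real.log 7 := by
  have h := Real.one_sub_inv_le_log_of_pos (by norm_num : (0 : ℝ) < 7 / 8)
  rw [Real.log_div (by norm_num) (by norm_num), show (8 : ℝ) = 2 ^ 3 by norm_num,
    Real.log_pow] at h
  norm_num at h
  linarith [Real.log_two_gt_d9]

theorem log_seven_upper : Real.log 7 < 1.9545 := by
  have h := Real.log_le_sub_one_of_pos (by norm_num : (0 : ℝ) < 7 / 8)
  rw [Real.log_div (by norm_num) (by norm_num), show (8 : ℝ) = 2 ^ 3 by norm_num,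
    Real.log_pow] at h
  norm_num at h
  linarith [Real.log_two_lt_d9]

theorem log_six : Real.log 6 = Real.log 2 + Real.log 3 := by
  rw [← Real.log_mul (by norm_num) (by norm_num)]
  norm_num

theorem log_four : Real.log 4 = 2 * Real.log 2 := by
  rw [show (4 : ℝ) = 2 ^ 2 by norm_num, Real.log_pow]
  norm_num

section

variable {ι : Type*} {s : Finset ι} {y : ι → ℝ}

/-- The case `n = 5` serves every `m ≤ 6`, since only an upper bound on the number of amplitudes is
used. The small regime has room, as `log (6/5) + (log 5)/3 ≈ 0.719` exceeds `log 2`. In the large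
regime `c = log 2` leaves no slack, so the remaining amplitudes repay the whole loss. -/
theorem entropy_bound_five (hcard : s.card ≤ 5)
    (hy : ∀ j ∈ s, 0 ≤ y j) (hy1 : ∀ j ∈ s, y j ≤ 1) (hsum : 1 ≤ ∑ j ∈ s, y j) :
    Real.log 2 * (1 + ∑ j ∈ s, y j ^ 2)
      ≤ (1 + ∑ j ∈ s, y j ^ 2) * Real.log (1 + ∑ j ∈ s, y j ^ 2)
        - ∑ j ∈ s, y j ^ 2 * (2 * Real.log (y j)) := by
  have l2 := Real.log_two_gt_d9
  have l2' := Real.log_two_lt_d9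
  have l3 := Real.log_three_gt_d9
  have l5 := Real.log_five_gt_d9
  have l5' := Real.log_five_lt_d9
  refine entropy_bound_of_few (n := 5) (a₀ := 0.43) (L := Real.log 5 / 6) (W := 13 / 3)
    (by norm_num) hcard (by norm_num) ?_ le_rfl (by push_cast; ring) (by push_cast; linarith)
    (by norm_num) ?_ (by norm_num) (by norm_num) ?_ ?_ hy hy1 hsum
  · have : Real.log (1 + 1 / (5 : ℕ)) = Real.log 6 - Real.log 5 := by
      rw [← Real.log_div (by norm_num) (by norm_num)]
      norm_num
    rw [this, log_six]
    linarith
  · have h1 : Real.log (0.43 * (5 : ℕ)) = Real.log 2 + Real.log 1.075 := by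
      rw [← Real.log_mul (by norm_num) (by norm_num)]
      norm_num
    have h2 := Real.log_le_sub_one_of_pos (by norm_num : (0 : ℝ) < 1.075)
    rw [h1]
    push_cast
    linarith
  · push_cast
    rw [show (5 - 1 : ℝ) = 4 by norm_num, log_four]
    linarith
  · have h1 : Real.exp (13 / 3 - 1) ≤ 28.1 := by
      -- The exponent is `10/3`; cubing turns it into an integer power of `e`.
      refine le_of_pow_le_pow_left₀ (n := 3) (by norm_num) (by norm_num) ?_
      rw [← Real.exp_nat_mul]
      have h2 : Real.exp ((3 : ℕ) * (13 / 3 - 1)) = Real.exp 1 ^ 10 := by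
        rw [← Real.exp_nat_mul]
        norm_num
      rw [h2]
      calc Real.exp 1 ^ 10 ≤ 2.7182818286 ^ 10 :=
            pow_le_pow_left₀ (Real.exp_pos _).le Real.exp_one_lt_d9.le 10
        _ ≤ _ := by norm_num
    push_cast
    linarith

/-- This is `m = 7`, where `c_k` first wins: the constant is about `0.666`, against `log 2 ≈ 0.693`.
-/
theorem entropy_bound_six (hcard : s.card ≤ 6)
    (hy : ∀ j ∈ s, 0 ≤ y j) (hy1 : ∀ j ∈ s, y j ≤ 1) (hsum : 1 ≤ ∑ j ∈ s, y j) :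
    (Real.log (1 + 1 / (6 : ℕ)) + 2 * (Real.log 6 / 7)) * (1 + ∑ j ∈ s, y j ^ 2)
      ≤ (1 + ∑ j ∈ s, y j ^ 2) * Real.log (1 + ∑ j ∈ s, y j ^ 2)
        - ∑ j ∈ s, y j ^ 2 * (2 * Real.log (y j)) := by
  have l2 := Real.log_two_gt_d9
  have l2' := Real.log_two_lt_d9
  have l3 := Real.log_three_gt_d9
  have l3' := Real.log_three_lt_d9
  have l5' := Real.log_five_lt_d9
  have l7 := log_seven_upper
  refine entropy_bound_of_few (n := 6) (a₀ := 1 / 2) (L := Real.log 6 / 7) (W := 5)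
    (by norm_num) hcard (by norm_num) le_rfl ?_ (by push_cast; ring)
    (by rw [log_six]; push_cast; linarith)
    (by norm_num) ?_ (by norm_num) (by norm_num) ?_ ?_ hy hy1 hsum
  · have : Real.log (1 + 1 / (6 : ℕ)) = Real.log 7 - Real.log 6 := by
      rw [← Real.log_div (by norm_num) (by norm_num)]
      norm_num
    rw [this, log_six]
    linarith
  · have h1 : (1 / 2 * (6 : ℕ) : ℝ) = 3 := by norm_num
    rw [h1, log_six]
    push_cast
    linarith
  · push_cast
    rw [show (6 - 1 : ℝ) = 5 by norm_num]
    linarith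
  · have h1 : Real.exp (5 - 1) = Real.exp 1 ^ 4 := by
      rw [← Real.exp_nat_mul]
      norm_num
    have h2 : Real.exp 1 ^ 4 ≤ 2.7182818286 ^ 4 :=
      pow_le_pow_left₀ (Real.exp_pos _).le Real.exp_one_lt_d9.le 4
    rw [h1]
    push_cast
    linarith

theorem entropy_bound_seven (hcard : s.card ≤ 7)
    (hy : ∀ j ∈ s, 0 ≤ y j) (hy1 : ∀ j ∈ s, y j ≤ 1) (hsum : 1 ≤ ∑ j ∈ s, y j) :
    (Real.log (1 + 1 / (7 : ℕ)) + 2 * (Real.log 7 / 8)) * (1 + ∑ j ∈ s, y j ^ 2)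
      ≤ (1 + ∑ j ∈ s, y j ^ 2) * Real.log (1 + ∑ j ∈ s, y j ^ 2)
        - ∑ j ∈ s, y j ^ 2 * (2 * Real.log (y j)) := by
  have l2 := Real.log_two_gt_d9
  have l2' := Real.log_two_lt_d9
  have l3' := Real.log_three_lt_d9
  have l7 := log_seven_lower
  refine entropy_bound_of_few (n := 7) (a₀ := 0.6) (L := Real.log 7 / 8) (W := 6)
    (by norm_num) hcard (by norm_num) le_rfl ?_ (by push_cast; ring)
    (by push_cast; linarith)
    (by norm_num) ?_ (by norm_num) (by norm_num) ?_ ?_ hy hy1 hsum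
  · have : Real.log (1 + 1 / (7 : ℕ)) = 3 * Real.log 2 - Real.log 7 := by
      rw [show 3 * Real.log 2 = Real.log (2 ^ 3) by rw [Real.log_pow]; norm_num,
        ← Real.log_div (by norm_num) (by norm_num)]
      norm_num
    rw [this]
    linarith
  · have h1 : Real.log (0.6 * (7 : ℕ)) = 2 * Real.log 2 + Real.log 1.05 := by
      rw [← log_four, ← Real.log_mul (by norm_num) (by norm_num)]
      norm_num
    have h2 := Real.log_le_sub_one_of_pos (by norm_num : (0 : ℝ) < 1.05)
    rw [h1]
    push_cast
    linarith
  · push_cast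
    rw [show (7 - 1 : ℝ) = 6 by norm_num, log_six]
    linarith
  · have h1 : Real.exp (6 - 1) = Real.exp 1 ^ 5 := by
      rw [← Real.exp_nat_mul]
      norm_num
    have h2 : Real.exp 1 ^ 5 ≤ 2.7182818286 ^ 5 :=
      pow_le_pow_left₀ (Real.exp_pos _).le Real.exp_one_lt_d9.le 5
    rw [h1]
    push_cast
    linarith

theorem log_sixty_two_hundredths_le : Real.log 0.62 ≤ -0.4777 := by
  -- The value `x = 19/81` solves `(1 + x)/(1 - x) = 1/0.62`; two terms of the series suffice.
  have h := Real.sum_range_le_log_div (x := 19 / 81) (by norm_num) (by norm_num) 2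
  rw [show (1 + 19 / 81) / (1 - 19 / 81) = (0.62 : ℝ)⁻¹ by norm_num, Real.log_inv] at h
  norm_num [Finset.sum_range_succ] at h ⊢
  linarith

theorem entropy_bound_ge_eight {n : ℕ} (hn : 8 ≤ n) (hcard : s.card ≤ n)
    (hy : ∀ j ∈ s, 0 ≤ y j) (hy1 : ∀ j ∈ s, y j ≤ 1) (hsum : 1 ≤ ∑ j ∈ s, y j) :
    (Real.log (1 + 1 / n) + 2 * (Real.log n / (n + 1))) * (1 + ∑ j ∈ s, y j ^ 2)
      ≤ (1 + ∑ j ∈ s, y j ^ 2) * Real.log (1 + ∑ j ∈ s, y j ^ 2)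
        - ∑ j ∈ s, y j ^ 2 * (2 * Real.log (y j)) := by
  have l2 := Real.log_two_gt_d9
  have l2' := Real.log_two_lt_d9
  have hn' : (8 : ℝ) ≤ n := by exact_mod_cast hn
  have hn0 : (0 : ℝ) < n := by linarith
  set L := Real.log n / (n + 1) with hLdef
  have hL : Real.log n = (n + 1) * L := by
    rw [hLdef]
    field_simp
  have hlog8 : Real.log 8 = 3 * Real.log 2 := by
    rw [show (8 : ℝ) = 2 ^ 3 by norm_num, Real.log_pow]
    norm_num
  have hLle : L ≤ Real.log 2 / 3 := by
    have h1 := Real.log_le_sub_one_of_pos (by positivity : (0 : ℝ) < n / 8)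
    rw [Real.log_div hn0.ne' (by norm_num), hlog8] at h1
    rw [hLdef, div_le_iff₀ (by linarith)]
    nlinarith
  have hLge : 1 ≤ n * L := by
    have h1 : Real.log 8 ≤ Real.log n := Real.log_le_log (by norm_num) hn'
    rw [hlog8] at h1
    rw [hLdef, mul_div_assoc', le_div_iff₀ (by linarith)]
    nlinarith
  have hc : Real.log (1 + 1 / n) ≤ 1 / 8 := by
    have h1 := Real.log_le_sub_one_of_pos (by positivity : (0 : ℝ) < 1 + 1 / n)
    have h2 : (1 : ℝ) / n ≤ 1 / 8 := by gcongr
    linarith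
  refine entropy_bound_of_many (n := n) (a₀ := 0.62) (by omega) hcard (by norm_num)
    rfl (by linarith) hL (by linarith) (by linarith) ?_ (by linarith) hy hy1 hsum
  -- After this substitution the terms in `n³ L` cancel. The quadratic part follows from `L ≤ (log
  -- 2)/3` and the bound on `log 0.62`, the rest from `n L ≥ 1`.
  rw [Real.log_mul (by norm_num) hn0.ne', hL]
  have h62 := log_sixty_two_hundredths_le
  have h1 : 2 * (0.62 * (n : ℝ)) ^ 2 * Real.log 0.62 ≤ 2 * (0.62 * (n : ℝ)) ^ 2 * (-0.4777) :=
    mul_le_mul_of_nonneg_left h62 (by positivity)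
  have h2 : (n : ℝ) ^ 2 * L ≤ n ^ 2 * (0.6931471808 / 3) :=
    mul_le_mul_of_nonneg_left (by linarith) (by positivity)
  have h3 : (0 : ℝ) ≤ n ^ 2 := by positivity
  linarith

theorem minEntropy_mul_le {m : ℕ} (hcard : s.card + 1 = m)
    (hy : ∀ j ∈ s, 0 ≤ y j) (hy1 : ∀ j ∈ s, y j ≤ 1) (hsum : 1 ≤ ∑ j ∈ s, y j) :
    minEntropy m * (1 + ∑ j ∈ s, y j ^ 2)
      ≤ (1 + ∑ j ∈ s, y j ^ 2) * Real.log (1 + ∑ j ∈ s, y j ^ 2)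
        - ∑ j ∈ s, y j ^ 2 * (2 * Real.log (y j)) := by
  rw [minEntropy]
  split_ifs with hm
  · exact entropy_bound_five (by omega) hy hy1 hsum
  · obtain ⟨n, rfl⟩ : ∃ n, m = n + 1 := ⟨m - 1, by omega⟩
    have hn : s.card ≤ n := by omega
    have hn0 : (0 : ℝ) < n := by exact_mod_cast (by omega : 0 < n)
    have hc : Real.log ((n + 1 : ℕ) : ℝ) - (((n + 1 : ℕ) : ℝ) - 2) / ((n + 1 : ℕ) : ℝ)
        * Real.log (((n + 1 : ℕ) : ℝ) - 1)
        = Real.log (1 + 1 / n) + 2 * (Real.log n / (n + 1)) := by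
      have h1 : (1 + 1 / n : ℝ) = (n + 1) / n := by field_simp
      rw [h1, Real.log_div (by positivity) hn0.ne']
      push_cast
      rw [add_sub_cancel_right]
      field_simp
      ring
    rw [hc]
    rcases (by omega : n = 6 ∨ n = 7 ∨ 8 ≤ n) with rfl | rfl | h8
    · have := entropy_bound_six hn hy hy1 hsum
      norm_num at this ⊢
      exact this
    · have := entropy_bound_seven hn hy hy1 hsum
      norm_num at this ⊢
      exact this
    · exact entropy_bound_ge_eight h8 hn hy hy1 hsum

end

/-! ### The entropy inequality for vectors with vanishing coordinate sum -/

/-- Both sides scale alike, so division by the largest `x i` turns `hpoly` at `i` into a sum of at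
least 1. -/
theorem minEntropy_mul_sum_sq_le {m : ℕ} {x : Fin m → ℝ} (hx : ∀ j, 0 ≤ x j)
    (hpoly : ∀ i, x i ≤ ∑ j ∈ univ.erase i, x j) :
    minEntropy m * ∑ j, x j ^ 2
      ≤ (∑ j, x j ^ 2) * Real.log (∑ j, x j ^ 2) - ∑ j, x j ^ 2 * (2 * Real.log (x j)) := by
  by_cases h0 : ∀ j, x j = 0
  · simp [h0]
  push Not at h0
  obtain ⟨j₀, hj₀⟩ := h0
  obtain ⟨i, -, hmax⟩ := exists_max_image univ x ⟨j₀, mem_univ _⟩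
  have hpos : 0 < x i := ((hx j₀).lt_of_ne' hj₀).trans_le (hmax j₀ (mem_univ _))
  set M := x i with hM
  have key := minEntropy_mul_le (s := univ.erase i) (y := fun j => x j / M) (m := m)
    (by
      rw [card_erase_of_mem (mem_univ _), card_univ, Fintype.card_fin]
      have := i.pos
      omega)
    (fun j _ => div_nonneg (hx j) hpos.le)
    (fun j _ => (div_le_one hpos).2 (hmax j (mem_univ _)))
    (by
      rw [← sum_div, one_le_div hpos]
      exact hpoly i)
  set S := ∑ j ∈ univ.erase i, (x j / M) ^ 2 with hS
  have hSnn : 0 ≤ S := sum_nonneg fun j _ => sq_nonneg _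
  have hQ : ∑ j, x j ^ 2 = M ^ 2 * (1 + S) := by
    rw [← add_sum_erase univ (fun j => x j ^ 2) (mem_univ i), hS, mul_add, mul_one, mul_sum]
    congr 1
    exact sum_congr rfl fun j _ => by field_simp
  have hlog : ∑ j, x j ^ 2 * (2 * Real.log (x j))
      = M ^ 2 * (1 + S) * (2 * Real.log M)
        + M ^ 2 * ∑ j ∈ univ.erase i, (x j / M) ^ 2 * (2 * Real.log (x j / M)) := by
    rw [← add_sum_erase univ (fun j => x j ^ 2 * (2 * Real.log (x j))) (mem_univ i), hS, mul_sum,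
      mul_add, add_mul, mul_one, add_assoc]
    congr 1
    rw [mul_sum, sum_mul, ← sum_add_distrib]
    refine sum_congr rfl fun j _ => ?_
    rcases (hx j).eq_or_lt with h | h
    · rw [← h]
      simp
    · rw [Real.log_div h.ne' hpos.ne']
      field_simp
      ring
  rw [hlog, hQ, Real.log_mul (by positivity) (by positivity), Real.log_pow]
  have h2 := mul_le_mul_of_nonneg_left key (sq_nonneg M)
  push_cast
  linarith

/-- Gibbs' inequality combined with the entropy inequality. -/
theorem minEntropy_mul_sum_norm_sq_le {m : ℕ} {z : Fin m → ℂ} {r : Fin m → ℝ}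
    (hz : ∑ j, z j = 0) (hr : ∀ j, 0 ≤ r j) (hr1 : ∑ j, r j ≤ 1)
    (hrz : ∀ j, r j = 0 → z j = 0) :
    minEntropy m * ∑ j, ‖z j‖ ^ 2 ≤ ∑ j, ‖z j‖ ^ 2 * -Real.log (r j) := by
  have hpoly : ∀ i, ‖z i‖ ≤ ∑ j ∈ univ.erase i, ‖z j‖ := fun i => by
    rw [← add_sum_erase univ z (mem_univ i)] at hz
    rw [eq_neg_of_add_eq_zero_left hz, norm_neg]
    exact norm_sum_le _ _
  refine (minEntropy_mul_sum_sq_le (fun j => norm_nonneg (z j)) hpoly).trans ?_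
  set Q := ∑ j, ‖z j‖ ^ 2 with hQ
  have hQnn : 0 ≤ Q := sum_nonneg fun j _ => sq_nonneg _
  -- This is `log t ≤ t - 1` at `t = r_j Q / |z_j|²`; summed, the right side is `(∑ r_j - 1) Q ≤ 0`.
  -- The hypothesis `hrz` is needed because `Real.log 0 = 0`, whereas `-log 0` should be `+∞`.
  have hterm : ∀ j, ‖z j‖ ^ 2 * Real.log Q - ‖z j‖ ^ 2 * (2 * Real.log ‖z j‖)
      - ‖z j‖ ^ 2 * -Real.log (r j) ≤ r j * Q - ‖z j‖ ^ 2 := fun j => by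
    by_cases h : z j = 0
    · simpa [h] using mul_nonneg (hr j) hQnn
    have hzpos : 0 < ‖z j‖ := norm_pos_iff.2 h
    have hrpos : 0 < r j := (hr j).lt_of_ne' fun h' => h (hrz j h')
    have hQpos : 0 < Q := (pow_pos hzpos 2).trans_le
      (single_le_sum (f := fun j => ‖z j‖ ^ 2) (fun j _ => sq_nonneg _) (mem_univ j))
    have h1 := Real.log_le_sub_one_of_pos (by positivity : 0 < r j * Q / ‖z j‖ ^ 2)
    rw [Real.log_div (by positivity) (by positivity), Real.log_mul hrpos.ne' hQpos.ne',
      Real.log_pow] at h1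
    have h2 := mul_le_mul_of_nonneg_left h1 (sq_nonneg ‖z j‖)
    have h3 : ‖z j‖ ^ 2 * (r j * Q / ‖z j‖ ^ 2 - 1) = r j * Q - ‖z j‖ ^ 2 := by field_simp
    rw [h3] at h2
    push_cast at h2
    linarith
  have h := sum_le_sum fun j (_ : j ∈ univ) => hterm j
  simp only [sum_sub_distrib, ← sum_mul, ← hQ] at h
  nlinarith

end QInfo

namespace QInfo

set_option linter.unusedSectionVars false

open Finset InnerProductSpace

variable {H : Type*} [NormedAddCommGroup H] [InnerProductSpace ℂ H] [FiniteDimensional ℂ H]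

/-! ### Traces -/

theorem tr_sub (A B : H →L[ℂ] H) : tr (A - B) = tr A - tr B := by
  simp [tr]

theorem tr_sum {κ : Type*} (s : Finset κ) (A : κ → (H →L[ℂ] H)) :
    tr (∑ k ∈ s, A k) = ∑ k ∈ s, tr (A k) := by
  simp [tr]

theorem tr_smul (c : ℝ) (A : H →L[ℂ] H) : tr ((c : ℂ) • A) = c * tr A := by
  simp [tr]

theorem tr_mul_comm (A B : H →L[ℂ] H) : tr (A * B) = tr (B * A) := by
  simp only [tr]
  congr 1
  exact LinearMap.trace_mul_comm ℂ (A : H →ₗ[ℂ] H) (B : H →ₗ[ℂ] H)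

theorem tr_mul_ketbra (A : H →L[ℂ] H) (v : H) : tr (A * ketbra v) = (inner ℂ v (A v)).re := by
  have h : A * ketbra v = rankOne ℂ (A v) v := by
    ext x
    simp [ketbra]
  rw [h, tr, trace_rankOne]

theorem tr_ketbra_mul (A : H →L[ℂ] H) (v : H) : tr (ketbra v * A) = (inner ℂ v (A v)).re := by
  rw [tr_mul_comm, tr_mul_ketbra]

theorem inner_ketbra_apply (u v : H) : (inner ℂ v (ketbra u v)).re = ‖inner ℂ v u‖ ^ 2 := by
  rw [ketbra, rankOne_apply, inner_smul_right, ← inner_conj_symm u v, mul_comm, Complex.mul_conj,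
    Complex.ofReal_re, Complex.normSq_eq_norm_sq]

theorem tr_ketbra (v : H) : tr (ketbra v) = ‖v‖ ^ 2 := by
  have h := tr_mul_ketbra (1 : H →L[ℂ] H) v
  rw [one_mul] at h
  rw [h]
  exact inner_self_eq_norm_sq (𝕜 := ℂ) v

theorem ketbra_mul_mul_ketbra_of_selfAdjoint [CompleteSpace H] {P : H →L[ℂ] H}
    (hP : IsSelfAdjoint P) {v : H} (hv : P v = v) : P * ketbra v * P = ketbra v := by
  ext x
  have h := ContinuousLinearMap.adjoint_inner_left P x v
  rw [← ContinuousLinearMap.star_eq_adjoint, hP.star_eq, hv] at h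
  change P (rankOne ℂ v v (P x)) = rankOne ℂ v v x
  rw [rankOne_apply, rankOne_apply, map_smul, hv, h]

/-! ### Vectors orthogonal to `e₀` -/

variable {m : ℕ}

/-- The orthogonal projection of `e_j` onto the complement of `e₀`. -/
noncomputable def centeredVec (b : OrthonormalBasis (Fin m) ℂ H) (j : Fin m) : H :=
  b j + (((-1) / Real.sqrt m : ℝ) : ℂ) • e0 b

/-- The orthogonal projection onto the complement of `e₀`. -/
noncomputable def centering (b : OrthonormalBasis (Fin m) ℂ H) : H →L[ℂ] H :=
  1 - ketbra (e0 b)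

theorem sum_ketbra_centeredVec (b : OrthonormalBasis (Fin m) ℂ H) (hm : 1 ≤ m) :
    ∑ j, ketbra (centeredVec b j) = centering b := by
  have h := sum_ketbra_shift b hm (-1)
  norm_num at h
  simp only [centeredVec, centering]
  rw [sub_eq_add_neg, ← h]
  norm_num

theorem inner_centeredVec_left (b : OrthonormalBasis (Fin m) ℂ H) (j : Fin m) (w : H) :
    inner ℂ (centeredVec b j) w
      = inner ℂ (b j) w - (((Real.sqrt m)⁻¹ : ℝ) : ℂ) * inner ℂ (e0 b) w := by
  rw [centeredVec, inner_add_left, inner_smul_left, Complex.conj_ofReal, neg_div, one_div]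
  push_cast
  ring

theorem inner_centeredVec_basis (b : OrthonormalBasis (Fin m) ℂ H) (j k : Fin m) :
    inner ℂ (centeredVec b j) (b k) = (((if j = k then 1 else 0) - 1 / m : ℝ) : ℂ) := by
  rw [inner_centeredVec_left, inner_e0_basis, OrthonormalBasis.inner_eq_ite, ← Complex.ofReal_mul,
    ← mul_inv, Real.mul_self_sqrt (Nat.cast_nonneg m)]
  split_ifs <;> simp

theorem inner_centeredVec_e0 (b : OrthonormalBasis (Fin m) ℂ H) (hm : 1 ≤ m) (j : Fin m) :
    inner ℂ (centeredVec b j) (e0 b) = 0 := by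
  rw [inner_centeredVec_left, inner_basis_e0, inner_e0_e0 b hm, mul_one, sub_self]

theorem sum_centeredVec (b : OrthonormalBasis (Fin m) ℂ H) (hm : 1 ≤ m) :
    ∑ j, centeredVec b j = 0 := by
  have h : ((Real.sqrt m : ℝ) : ℂ) ≠ 0 := by
    exact_mod_cast (Real.sqrt_pos.2 (by exact_mod_cast hm : (0 : ℝ) < m)).ne'
  have hsq : ((Real.sqrt m : ℝ) : ℂ) ^ 2 = m := by
    exact_mod_cast congrArg (fun x : ℝ => (x : ℂ)) (Real.sq_sqrt (Nat.cast_nonneg (α := ℝ) m))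
  simp only [centeredVec]
  rw [sum_add_distrib, sum_basis b hm, sum_const, card_univ, Fintype.card_fin,
    ← Nat.cast_smul_eq_nsmul ℂ, smul_smul, ← add_smul, ← hsq]
  push_cast
  rw [show ((Real.sqrt m : ℝ) : ℂ) + ((Real.sqrt m : ℝ) : ℂ) ^ 2 * (-1 / ((Real.sqrt m : ℝ) : ℂ))
    = 0 by field_simp; ring, zero_smul]

theorem sum_inner_centeredVec (b : OrthonormalBasis (Fin m) ℂ H) (hm : 1 ≤ m) (w : H) :
    ∑ j, inner ℂ (centeredVec b j) w = 0 := by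
  rw [← sum_inner, sum_centeredVec b hm, inner_zero_left]

theorem isSelfAdjoint_centering [CompleteSpace H] (b : OrthonormalBasis (Fin m) ℂ H) :
    IsSelfAdjoint (centering b) :=
  (IsSelfAdjoint.one _).sub (isPositive_rankOne_self _).isSelfAdjoint

theorem isIdempotentElem_centering (b : OrthonormalBasis (Fin m) ℂ H) (hm : 1 ≤ m) :
    IsIdempotentElem (centering b) := by
  refine IsIdempotentElem.one_sub ?_
  refine isIdempotentElem_rankOne_self ?_
  have h := inner_self_eq_norm_sq_to_K (𝕜 := ℂ) (e0 b)
  rw [inner_e0_e0 b hm] at h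
  have h2 : (‖e0 b‖ : ℝ) ^ 2 = 1 := by
    have h' := congrArg Complex.re h
    norm_cast at h'
    exact h'.symm
  exact (pow_eq_one_iff_of_nonneg (norm_nonneg _) two_ne_zero).1 h2

theorem centering_centeredVec (b : OrthonormalBasis (Fin m) ℂ H) (hm : 1 ≤ m) (j : Fin m) :
    centering b (centeredVec b j) = centeredVec b j := by
  have h : inner ℂ (e0 b) (centeredVec b j) = 0 := by
    rw [← inner_conj_symm, inner_centeredVec_e0 b hm, map_zero]
  simp [centering, ketbra, h]

theorem inner_centering (b : OrthonormalBasis (Fin m) ℂ H) (hm : 1 ≤ m) (w : H) :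
    (inner ℂ w (centering b w)).re = ∑ j, ‖inner ℂ (centeredVec b j) w‖ ^ 2 := by
  rw [← sum_ketbra_centeredVec b hm, _root_.sum_apply, inner_sum, Complex.re_sum]
  refine sum_congr rfl fun j _ => ?_
  rw [inner_ketbra_apply, ← inner_conj_symm, RCLike.norm_conj]

theorem tr_centering (b : OrthonormalBasis (Fin m) ℂ H) (hm : 1 ≤ m) :
    tr (centering b) = m - 1 := by
  have h1 : ‖e0 b‖ ^ 2 = 1 := by
    have h := inner_self_eq_norm_sq (𝕜 := ℂ) (e0 b)
    rw [inner_e0_e0 b hm] at h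
    simpa using h.symm
  rw [centering, tr_sub, tr_ketbra, h1, ← sum_ketbra_basis b, tr_sum]
  simp [tr_ketbra]

/-! ### The flat pyramid and its dual effects -/

theorem pyramidVec_eq (b : OrthonormalBasis (Fin m) ℂ H) (hm : 1 ≤ m) (r : ℝ) (j : Fin m) :
    pyramidVec b 0 r j = ((Real.sqrt (m * r) : ℝ) : ℂ) • centeredVec b j := by
  have h : Real.sqrt m ≠ 0 := (Real.sqrt_pos.2 (by exact_mod_cast hm : (0 : ℝ) < m)).ne'
  rw [pyramidVec, centeredVec, smul_add, smul_smul, ← Complex.ofReal_mul,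
    Real.sqrt_mul (Nat.cast_nonneg m), Real.sqrt_zero]
  congr 4
  field_simp
  ring

theorem flatPyramid_prob (b : OrthonormalBasis (Fin m) ℂ H) (hm : 2 ≤ m) (j : Fin m) :
    (flatPyramid b hm).prob j = 1 / m := rfl

theorem flatPyramid_state (b : OrthonormalBasis (Fin m) ℂ H) (hm : 2 ≤ m) (j : Fin m) :
    (flatPyramid b hm).state j = ((m / (m - 1) : ℝ) : ℂ) • ketbra (centeredVec b j) := by
  have h1 : (0 : ℝ) < m - 1 := by
    have : (2 : ℝ) ≤ m := by exact_mod_cast hm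
    linarith
  change ketbra (pyramidVec b 0 (1 / (m - 1)) j) = _
  rw [pyramidVec_eq b (by omega), ketbra_smul, Real.sq_sqrt (by positivity), mul_one_div]

theorem flatPyramid_prob_smul_state (b : OrthonormalBasis (Fin m) ℂ H) (hm : 2 ≤ m)
    (j : Fin m) : ((flatPyramid b hm).prob j : ℂ) • (flatPyramid b hm).state j
      = ((1 / (m - 1) : ℝ) : ℂ) • ketbra (centeredVec b j) := by
  have h0 : (m : ℝ) ≠ 0 := by exact_mod_cast (by omega : m ≠ 0)
  rw [flatPyramid_state, flatPyramid_prob, smul_smul, ← Complex.ofReal_mul]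
  congr 2
  field_simp

theorem avgState_flatPyramid (b : OrthonormalBasis (Fin m) ℂ H) (hm : 2 ≤ m) :
    avgState (flatPyramid b hm) = ((1 / (m - 1) : ℝ) : ℂ) • centering b := by
  simp only [avgState, flatPyramid_prob_smul_state, ← smul_sum]
  rw [sum_ketbra_centeredVec b (by omega)]

theorem avgInvSqrt_flatPyramid [CompleteSpace H] (b : OrthonormalBasis (Fin m) ℂ H)
    (hm : 2 ≤ m) :
    avgInvSqrt (flatPyramid b hm) = ((Real.sqrt (m - 1) : ℝ) : ℂ) • centering b := by
  have h1 : (0 : ℝ) < m - 1 := by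
    have : (2 : ℝ) ≤ m := by exact_mod_cast hm
    linarith
  have hsa := isSelfAdjoint_centering b
  have hspec := (isIdempotentElem_centering b (by omega : 1 ≤ m)).spectrum_subset ℝ
  rw [avgInvSqrt, avgState_flatPyramid, Complex.coe_smul, Complex.coe_smul,
    ← cfc_const_mul_id (1 / (m - 1) : ℝ) (centering b) hsa,
    ← cfc_comp' (fun x : ℝ => (Real.sqrt x)⁻¹) (fun x : ℝ => 1 / (m - 1) * x) (centering b)
      (((Set.toFinite ({0, 1} : Set ℝ)).subset hspec).image _ |>.continuousOn _) ,
    ← cfc_const_mul_id (Real.sqrt (m - 1)) (centering b) hsa]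
  -- The spectrum of the projection lies in `{0, 1}`; at `0` both functions vanish.
  refine cfc_congr fun x hx => ?_
  rcases hspec hx with rfl | hx
  · simp
  · rw [Set.mem_singleton_iff.1 hx]
    simp

theorem dualEffect_flatPyramid [CompleteSpace H] (b : OrthonormalBasis (Fin m) ℂ H)
    (hm : 2 ≤ m) (j : Fin m) :
    dualEffect (flatPyramid b hm) j = ketbra (centeredVec b j) := by
  have h1 : (0 : ℝ) < m - 1 := by
    have : (2 : ℝ) ≤ m := by exact_mod_cast hm
    linarith
  rw [dualEffect, avgInvSqrt_flatPyramid, flatPyramid_prob_smul_state, smul_mul_smul_comm,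
    smul_mul_smul_comm, ketbra_mul_mul_ketbra_of_selfAdjoint (isSelfAdjoint_centering b)
      (centering_centeredVec b (by omega) j), ← Complex.ofReal_mul, ← Complex.ofReal_mul]
  have h2 : Real.sqrt (m - 1) * (1 / (m - 1)) * Real.sqrt (m - 1) = 1 := by
    have h3 := Real.mul_self_sqrt h1.le
    field_simp
    linarith
  rw [h2, Complex.ofReal_one, one_smul]

variable {κ : Type*} [Fintype κ]

/-! ### The upper bound for the mutual information -/

/-- The entropy inequality for a positive operator. -/
theorem minEntropy_mul_sum_le_of_isPositive (b : OrthonormalBasis (Fin m) ℂ H) (hm : 1 ≤ m)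
    {A : H →L[ℂ] H} (hA : A.IsPositive) {r : Fin m → ℝ} (hr : ∀ j, 0 ≤ r j)
    (hr1 : ∑ j, r j ≤ 1)
    (hrz : ∀ j, r j = 0 → (inner ℂ (centeredVec b j) (A (centeredVec b j))).re = 0) :
    minEntropy m * ∑ j, (inner ℂ (centeredVec b j) (A (centeredVec b j))).re
      ≤ ∑ j, (inner ℂ (centeredVec b j) (A (centeredVec b j))).re * -Real.log (r j) := by
  -- Each rank-one piece is compared with the same `r`, so no separate concavity argument for mixed
  -- effects is required.
  obtain ⟨n, u, rfl⟩ := ContinuousLinearMap.isPositive_iff_eq_sum_rankOne.1 hA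
  have hexp : ∀ j, (inner ℂ (centeredVec b j)
      ((∑ i, rankOne ℂ (u i) (u i) : H →L[ℂ] H) (centeredVec b j))).re
      = ∑ i, ‖inner ℂ (centeredVec b j) (u i)‖ ^ 2 := fun j => by
    rw [_root_.sum_apply, inner_sum, Complex.re_sum]
    exact sum_congr rfl fun i _ => inner_ketbra_apply (u i) _
  simp only [hexp] at hrz ⊢
  simp only [sum_mul]
  rw [sum_comm, sum_comm (f := fun j i => _ * -Real.log (r j)), mul_sum]
  refine sum_le_sum fun i _ => minEntropy_mul_sum_norm_sq_le (sum_inner_centeredVec b hm (u i)) hr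
    hr1 fun j hj => ?_
  have h := (sum_eq_zero_iff_of_nonneg fun i _ => sq_nonneg _).1 (hrz j hj) i (mem_univ i)
  simpa using h

theorem jointProb_flatPyramid (b : OrthonormalBasis (Fin m) ℂ H) (hm : 2 ≤ m)
    (M : Observable H κ) (j : Fin m) (k : κ) :
    jointProb (flatPyramid b hm) M j k
      = 1 / (m - 1) * (inner ℂ (centeredVec b j) (M.effect k (centeredVec b j))).re := by
  have h : jointProb (flatPyramid b hm) M j k
      = tr ((((flatPyramid b hm).prob j : ℂ) • (flatPyramid b hm).state j) * M.effect k) := by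
    rw [jointProb, smul_mul_assoc, tr_smul]
  rw [h, flatPyramid_prob_smul_state, smul_mul_assoc, tr_smul, tr_ketbra_mul]

theorem jointProb_flatPyramid_nonneg (b : OrthonormalBasis (Fin m) ℂ H) (hm : 2 ≤ m)
    (M : Observable H κ) (j : Fin m) (k : κ) : 0 ≤ jointProb (flatPyramid b hm) M j k := by
  have h1 : (0 : ℝ) < m - 1 := by
    have : (2 : ℝ) ≤ m := by exact_mod_cast hm
    linarith
  rw [jointProb_flatPyramid]
  exact mul_nonneg (by positivity) ((M.isPositive k).re_inner_nonneg_right _)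

theorem sum_jointProb_flatPyramid (b : OrthonormalBasis (Fin m) ℂ H) (hm : 2 ≤ m)
    (M : Observable H κ) : ∑ k, ∑ j, jointProb (flatPyramid b hm) M j k = 1 := by
  have h1 : (m : ℝ) - 1 ≠ 0 := by
    have : (2 : ℝ) ≤ m := by exact_mod_cast hm
    linarith
  rw [sum_comm]
  have h : ∀ j, ∑ k, jointProb (flatPyramid b hm) M j k
      = 1 / (m - 1) * tr (ketbra (centeredVec b j)) := fun j => by
    simp only [jointProb_flatPyramid, ← tr_ketbra_mul, ← mul_sum]
    rw [← tr_sum, ← mul_sum, M.sum_effect, mul_one]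
  simp only [h, ← mul_sum]
  rw [← tr_sum, sum_ketbra_centeredVec b (by omega), tr_centering b (by omega)]
  field_simp

theorem mutualInfo_flatPyramid (b : OrthonormalBasis (Fin m) ℂ H) (hm : 2 ≤ m)
    (M : Observable H κ) :
    mutualInfo (flatPyramid b hm) M = Real.logb 2 m
      - (∑ k, ∑ j, jointProb (flatPyramid b hm) M j k
        * -Real.log (jointProb (flatPyramid b hm) M j k / outProb (flatPyramid b hm) M k))
        / Real.log 2 := by
  have hm0 : (m : ℝ) ≠ 0 := by exact_mod_cast (by omega : m ≠ 0)
  have hterm : ∀ k j, jointProb (flatPyramid b hm) M j k *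
      Real.logb 2 (jointProb (flatPyramid b hm) M j k
        / ((flatPyramid b hm).prob j * outProb (flatPyramid b hm) M k))
      = jointProb (flatPyramid b hm) M j k * Real.logb 2 m
        - jointProb (flatPyramid b hm) M j k
        * -Real.log (jointProb (flatPyramid b hm) M j k / outProb (flatPyramid b hm) M k)
        / Real.log 2 := fun k j => by
    by_cases h0 : jointProb (flatPyramid b hm) M j k = 0
    · simp [h0]
    have hpos := (jointProb_flatPyramid_nonneg b hm M j k).lt_of_ne' h0
    have hout : 0 < outProb (flatPyramid b hm) M k := hpos.trans_le
      (single_le_sum (f := fun j => jointProb (flatPyramid b hm) M j k)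
        (fun j _ => jointProb_flatPyramid_nonneg b hm M j k) (mem_univ j))
    rw [flatPyramid_prob, Real.logb, Real.logb, Real.log_div h0 (by positivity),
      Real.log_mul (by positivity) hout.ne', Real.log_div h0 hout.ne', one_div, Real.log_inv]
    ring
  rw [mutualInfo, sum_comm]
  simp only [hterm, sum_sub_distrib, ← sum_mul, ← sum_div]
  rw [sum_jointProb_flatPyramid, one_mul]

/-- The entropy inequality is applied to each effect, with `r` the posterior distribution of `j`
given the outcome. -/
theorem mutualInfo_flatPyramid_le (b : OrthonormalBasis (Fin m) ℂ H) (hm : 2 ≤ m)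
    (M : Observable H κ) :
    mutualInfo (flatPyramid b hm) M ≤ Real.logb 2 m - minEntropy m / Real.log 2 := by
  have hlog : 0 < Real.log 2 := Real.log_pos one_lt_two
  have h1 : (0 : ℝ) < m - 1 := by
    have : (2 : ℝ) ≤ m := by exact_mod_cast hm
    linarith
  rw [mutualInfo_flatPyramid]
  gcongr
  calc minEntropy m
      = ∑ k, minEntropy m * ∑ j, jointProb (flatPyramid b hm) M j k := by
        rw [← mul_sum, sum_jointProb_flatPyramid, mul_one]
    _ ≤ _ := sum_le_sum fun k _ => ?_
  have hnn := fun j => jointProb_flatPyramid_nonneg b hm M j k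
  have hout : 0 ≤ outProb (flatPyramid b hm) M k := sum_nonneg fun j _ => hnn j
  have key := minEntropy_mul_sum_le_of_isPositive b (by omega) (M.isPositive k)
    (r := fun j => jointProb (flatPyramid b hm) M j k / outProb (flatPyramid b hm) M k)
    (fun j => div_nonneg (hnn j) hout) (by
      rw [← sum_div]
      -- This also covers outcomes of probability zero.
      exact div_self_le_one _) fun j hj => by
      have hj0 : jointProb (flatPyramid b hm) M j k = 0 := by
        rcases div_eq_zero_iff.1 hj with h | h
        · exact h
        · exact (sum_eq_zero_iff_of_nonneg fun j _ => hnn j).1 h j (mem_univ j)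
      rw [jointProb_flatPyramid] at hj0
      exact (mul_eq_zero.1 hj0).resolve_left (by positivity)
  have h2 := mul_le_mul_of_nonneg_left key (by positivity : (0 : ℝ) ≤ 1 / (m - 1))
  simp only [jointProb_flatPyramid, ← mul_sum, mul_assoc] at h2 ⊢
  linarith

/-! ### Vectors of minimal entropy -/

/-- The components of `v` orthogonal to `e₀` have the minimal entropy. -/
def HasMinEntropy (b : OrthonormalBasis (Fin m) ℂ H) (v : H) : Prop :=
  ∑ j, ‖inner ℂ (centeredVec b j) v‖ ^ 2
      * -Real.log (‖inner ℂ (centeredVec b j) v‖ ^ 2 / ∑ i, ‖inner ℂ (centeredVec b i) v‖ ^ 2)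
    = minEntropy m * ∑ j, ‖inner ℂ (centeredVec b j) v‖ ^ 2

theorem mutualInfo_flatPyramid_eq_of_hasMinEntropy (b : OrthonormalBasis (Fin m) ℂ H)
    (hm : 2 ≤ m) (M : Observable H κ) (w : κ → ℝ) (v : κ → H)
    (hM : ∀ k, M.effect k = ((w k : ℝ) : ℂ) • ketbra (v k))
    (hv : ∀ k, HasMinEntropy b (v k)) :
    mutualInfo (flatPyramid b hm) M = Real.logb 2 m - minEntropy m / Real.log 2 := by
  have hjoint : ∀ j k, jointProb (flatPyramid b hm) M j k
      = 1 / (m - 1) * w k * ‖inner ℂ (centeredVec b j) (v k)‖ ^ 2 := fun j k => by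
    rw [jointProb_flatPyramid, hM, _root_.smul_apply, inner_smul_right, Complex.re_ofReal_mul,
      inner_ketbra_apply, mul_assoc]
  rw [mutualInfo_flatPyramid]
  congr 2
  calc _ = ∑ k, minEntropy m * ∑ j, jointProb (flatPyramid b hm) M j k :=
        sum_congr rfl fun k _ => ?_
    _ = minEntropy m := by rw [← mul_sum, sum_jointProb_flatPyramid, mul_one]
  simp only [outProb, hjoint, ← mul_sum, mul_assoc]
  rw [mul_left_comm (minEntropy m), mul_left_comm (minEntropy m), ← hv k]
  by_cases hc : 1 / ((m : ℝ) - 1) = 0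
  · simp [hc]
  by_cases hw : w k = 0
  · simp [hw]
  simp only [mul_div_mul_left _ _ hc, mul_div_mul_left _ _ hw]

theorem HasMinEntropy.smul {b : OrthonormalBasis (Fin m) ℂ H} {v : H} (hv : HasMinEntropy b v)
    (c : ℂ) : HasMinEntropy b (c • v) := by
  by_cases hc : c = 0
  · simp [HasMinEntropy, hc]
  have hc' : ‖c‖ ^ 2 ≠ 0 := by simpa using hc
  simp only [HasMinEntropy, inner_smul_right, norm_mul, mul_pow, ← mul_sum,
    mul_div_mul_left _ _ hc', mul_assoc] at hv ⊢
  rw [hv]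
  ring

theorem hasMinEntropy_e0 (b : OrthonormalBasis (Fin m) ℂ H) (hm : 1 ≤ m) :
    HasMinEntropy b (e0 b) := by
  simp [HasMinEntropy, inner_centeredVec_e0 b hm]

/-- The `c_j` are orthogonal to `e₀`, so the ensemble does not see an `e₀` component. -/
theorem hasMinEntropy_add_e0 {b : OrthonormalBasis (Fin m) ℂ H} (hm : 1 ≤ m) {v : H}
    (hv : HasMinEntropy b v) (c : ℂ) : HasMinEntropy b (v + c • e0 b) := by
  simpa only [HasMinEntropy, inner_add_right, inner_smul_right, inner_centeredVec_e0 b hm,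
    mul_zero, add_zero] using hv

theorem norm_inner_centeredVec_basis_sq (b : OrthonormalBasis (Fin m) ℂ H) (j k : Fin m) :
    ‖inner ℂ (centeredVec b j) (b k)‖ ^ 2
      = if j = k then (1 - 1 / (m : ℝ)) ^ 2 else (1 / (m : ℝ)) ^ 2 := by
  rw [inner_centeredVec_basis, Complex.norm_real, Real.norm_eq_abs, sq_abs]
  split_ifs <;> ring

theorem hasMinEntropy_basis (b : OrthonormalBasis (Fin m) ℂ H) (hm : 7 ≤ m) (k : Fin m) :
    HasMinEntropy b (b k) := by
  have hm' : (7 : ℝ) ≤ m := by exact_mod_cast hm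
  have h0 : (m : ℝ) ≠ 0 := by linarith
  have h1 : (m : ℝ) - 1 ≠ 0 := by linarith
  have hcard : ∀ c : ℝ, ∑ j ∈ univ.erase k, c = (m - 1) * c := fun c => by
    rw [sum_const, card_erase_of_mem (mem_univ _), card_univ, Fintype.card_fin, nsmul_eq_mul,
      Nat.cast_sub (by omega), Nat.cast_one]
  have hsum : ∀ (f : Fin m → ℝ) (c : ℝ), (∀ j ≠ k, f j = c) → ∑ j, f j = f k + (m - 1) * c :=
    fun f c hf => by
      rw [← add_sum_erase univ f (mem_univ k), ← hcard c]
      congr 1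
      exact sum_congr rfl fun j hj => hf j (ne_of_mem_erase hj)
  have hQ : ∑ i, ‖inner ℂ (centeredVec b i) (b k)‖ ^ 2 = ((m : ℝ) - 1) / m := by
    rw [hsum _ ((1 / (m : ℝ)) ^ 2) fun j hj => by
      rw [norm_inner_centeredVec_basis_sq, if_neg hj], norm_inner_centeredVec_basis_sq, if_pos rfl]
    field_simp
    ring
  -- The normalized weights are `(m-1)/m` once and `1/(m(m-1))` for the other `m - 1` indices.
  rw [HasMinEntropy, hQ, hsum _ ((1 / (m : ℝ)) ^ 2 * (Real.log m + Real.log (m - 1))) fun j hj => by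
      rw [norm_inner_centeredVec_basis_sq, if_neg hj,
        show (1 / (m : ℝ)) ^ 2 / ((m - 1) / m) = ((m : ℝ) * (m - 1))⁻¹ by field_simp, Real.log_inv,
        Real.log_mul h0 h1, neg_neg],
    norm_inner_centeredVec_basis_sq, if_pos rfl,
    show (1 - 1 / (m : ℝ)) ^ 2 / ((m - 1) / m) = (m - 1) / m by field_simp, Real.log_div h1 h0,
    minEntropy, if_neg (by omega)]
  field_simp
  ring

theorem inner_centeredVec_pairVec (b : OrthonormalBasis (Fin m) ℂ H) (j r s : Fin m) :
    inner ℂ (centeredVec b j) (pairVec b r s)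
      = ((1 / Real.sqrt 2 * ((if j = r then 1 else 0) - if j = s then 1 else 0) : ℝ) : ℂ) := by
  rw [pairVec, inner_smul_right, inner_sub_right, inner_centeredVec_basis, inner_centeredVec_basis]
  push_cast
  ring

theorem norm_inner_centeredVec_pairVec_sq (b : OrthonormalBasis (Fin m) ℂ H) {r s : Fin m}
    (hrs : r ≠ s) (j : Fin m) : ‖inner ℂ (centeredVec b j) (pairVec b r s)‖ ^ 2
      = (if j = r then 1 / 2 else 0) + if j = s then 1 / 2 else 0 := by
  rw [inner_centeredVec_pairVec, Complex.norm_real, Real.norm_eq_abs, sq_abs, mul_pow, div_pow,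
    Real.sq_sqrt zero_le_two]
  by_cases h1 : j = r <;> by_cases h2 : j = s
  · exact absurd (h1.symm.trans h2) hrs
  all_goals simp [h1, h2]
  all_goals simp [hrs, hrs.symm]

theorem hasMinEntropy_pairVec (b : OrthonormalBasis (Fin m) ℂ H) (hm : m ≤ 6) {r s : Fin m}
    (hrs : r ≠ s) : HasMinEntropy b (pairVec b r s) := by
  have hQ : ∑ i, ‖inner ℂ (centeredVec b i) (pairVec b r s)‖ ^ 2 = 1 := by
    simp only [norm_inner_centeredVec_pairVec_sq b hrs, sum_add_distrib, sum_ite_eq', mem_univ,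
      if_true]
    norm_num
  rw [HasMinEntropy, hQ, minEntropy, if_pos hm, mul_one]
  have hterm : ∀ j, ‖inner ℂ (centeredVec b j) (pairVec b r s)‖ ^ 2
      * -Real.log (‖inner ℂ (centeredVec b j) (pairVec b r s)‖ ^ 2 / 1)
      = ‖inner ℂ (centeredVec b j) (pairVec b r s)‖ ^ 2 * Real.log 2 := fun j => by
    rw [norm_inner_centeredVec_pairVec_sq b hrs, div_one]
    by_cases h1 : j = r <;> by_cases h2 : j = s
    · exact absurd (h1.symm.trans h2) hrs
    all_goals simp [h1, h2]
    all_goals simp [hrs, hrs.symm]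
  simp only [hterm, ← sum_mul, hQ, one_mul]


/-! ### Attaining observables and the accessible information -/

/-- Relabelling the outcomes of an observable. -/
def Observable.reindex {κ' : Type*} [Fintype κ'] (M : Observable H κ) (e : κ' ≃ κ) :
    Observable H κ' where
  effect k := M.effect (e k)
  isPositive k := M.isPositive (e k)
  sum_effect := by rw [e.sum_comp M.effect, M.sum_effect]

theorem mutualInfo_reindex {ι κ' : Type*} [Fintype ι] [Fintype κ'] (E : Ensemble H ι)
    (M : Observable H κ) (e : κ' ≃ κ) : mutualInfo E (M.reindex e) = mutualInfo E M :=
  sum_congr rfl fun j _ => e.sum_comp fun k => jointProb E M j k *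
    Real.logb 2 (jointProb E M j k / (E.prob j * outProb E M k))

theorem accessibleInfo_flatPyramid_eq (b : OrthonormalBasis (Fin m) ℂ H) (hm : 2 ≤ m)
    (M : Observable H κ)
    (hM : mutualInfo (flatPyramid b hm) M = Real.logb 2 m - minEntropy m / Real.log 2) :
    accessibleInfo (flatPyramid b hm) = Real.logb 2 m - minEntropy m / Real.log 2 := by
  refine IsGreatest.csSup_eq ⟨?_, ?_⟩
  · exact ⟨_, M.reindex (Fintype.equivFin κ).symm, by rw [mutualInfo_reindex, hM]⟩
  · rintro x ⟨n, N, rfl⟩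
    exact mutualInfo_flatPyramid_le b hm N

theorem mutualInfo_pyramidObservable_one (b : OrthonormalBasis (Fin m) ℂ H) (hm : 7 ≤ m) :
    mutualInfo (flatPyramid b (by omega)) (pyramidObservable b (by omega : 1 ≤ m) 1 le_rfl)
      = Real.logb 2 m - minEntropy m / Real.log 2 := by
  -- At `t = 1` the vector `ẽ_k` is `e_k` and the pair effects vanish; the zero vector stands for
  -- them.
  refine mutualInfo_flatPyramid_eq_of_hasMinEntropy b (by omega) _
    (Sum.elim (fun _ => 1) fun _ => 0) (Sum.elim (fun k => eTilde b 1 k) fun _ => 0) ?_ ?_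
  · rintro (k | p) <;> simp [pyramidObservable, pyramidEffect]
  · rintro (k | p)
    · exact hasMinEntropy_add_e0 (by omega) (hasMinEntropy_basis b hm k) _
    · simp [HasMinEntropy]

theorem mutualInfo_pyramidObservableTop (b : OrthonormalBasis (Fin m) ℂ H) (hm : 2 ≤ m)
    (hm6 : m ≤ 6) :
    mutualInfo (flatPyramid b hm) (pyramidObservableTop b (by omega : 1 ≤ m))
      = Real.logb 2 m - minEntropy m / Real.log 2 := by
  refine mutualInfo_flatPyramid_eq_of_hasMinEntropy b hm _
    (Sum.elim (fun _ => 1 / m) fun _ => 2 / m)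
    (Sum.elim (fun _ => e0 b) fun p => pairVec b p.1.1 p.1.2) ?_ ?_
  · rintro (k | p) <;> rfl
  · rintro (k | p)
    · exact hasMinEntropy_e0 b (by omega)
    · exact hasMinEntropy_pairVec b hm6 p.2.ne

/-! ### The dual problem -/

theorem negLog_nonneg {x : ℝ} (hx : x ≤ 1) : 0 ≤ negLog x := by
  rw [negLog]
  split_ifs with h
  · exact le_top
  · push Not at h
    rw [EReal.coe_nonneg, Real.logb, neg_nonneg]
    exact div_nonpos_of_nonpos_of_nonneg (Real.log_nonpos h.le hx) (Real.log_pos one_lt_two).le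

theorem coe_mul_negLog {q x : ℝ} (hx : 0 ≤ x) (h : x = 0 → q = 0) :
    (q : EReal) * negLog x = ((q * -Real.log x / Real.log 2 : ℝ) : EReal) := by
  rw [negLog]
  split_ifs with h0
  · rw [h (le_antisymm h0 hx)]
    simp
  · rw [← EReal.coe_mul, Real.logb]
    congr 1
    ring

theorem coe_ereal_sum {ι : Type*} (s : Finset ι) (f : ι → ℝ) :
    ((∑ i ∈ s, f i : ℝ) : EReal) = ∑ i ∈ s, (f i : EReal) := by
  classical
  induction s using Finset.induction_on with
  | empty => simp
  | insert i s hi ih => rw [sum_insert hi, sum_insert hi, EReal.coe_add, ih]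

theorem dualForm_flatPyramid [CompleteSpace H] (b : OrthonormalBasis (Fin m) ℂ H) (hm : 2 ≤ m)
    (σ : H →L[ℂ] H) (ψ : H) :
    dualForm (flatPyramid b hm) σ ψ = ∑ j, ((‖inner ℂ (centeredVec b j) ψ‖ ^ 2 : ℝ) : EReal)
      * negLog (inner ℂ (centeredVec b j) (σ (centeredVec b j))).re := by
  refine sum_congr rfl fun j _ => ?_
  rw [dualEffect_flatPyramid, tr_mul_ketbra, inner_ketbra_apply, ← inner_conj_symm,
    RCLike.norm_conj]

theorem dualForm_eq_coe_of_eq_zero_imp [CompleteSpace H] (b : OrthonormalBasis (Fin m) ℂ H)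
    (hm : 2 ≤ m) {σ : H →L[ℂ] H} (hσ : σ.IsPositive) {ψ : H}
    (h : ∀ j, (inner ℂ (centeredVec b j) (σ (centeredVec b j))).re = 0 →
      inner ℂ (centeredVec b j) ψ = 0) :
    dualForm (flatPyramid b hm) σ ψ = ((∑ j, ‖inner ℂ (centeredVec b j) ψ‖ ^ 2
      * -Real.log (inner ℂ (centeredVec b j) (σ (centeredVec b j))).re / Real.log 2 : ℝ)
        : EReal) := by
  rw [dualForm_flatPyramid, coe_ereal_sum]
  exact sum_congr rfl fun j _ => coe_mul_negLog (hσ.re_inner_nonneg_right _) fun h0 => by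
    simp [h j h0]

/-- The numbers `r_j = Tr σ M'_j` sum to `1 - ⟨e₀|σ|e₀⟩ ≤ 1`, so Gibbs' inequality applies whenever
the form is finite. -/
theorem isDualFeasible_centering [CompleteSpace H] (b : OrthonormalBasis (Fin m) ℂ H)
    (hm : 2 ≤ m) :
    IsDualFeasible (flatPyramid b hm)
      (((minEntropy m / Real.log 2 : ℝ) : ℂ) • centering b) := by
  have hlog : 0 < Real.log 2 := Real.log_pos one_lt_two
  refine ⟨?_, fun σ hσ ψ => ?_⟩
  · exact IsSelfAdjoint.smul (R := ℂ) (Complex.conj_ofReal _) (isSelfAdjoint_centering b)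
  have hr : ∀ j, 0 ≤ (inner ℂ (centeredVec b j) (σ (centeredVec b j))).re := fun j =>
    hσ.1.re_inner_nonneg_right _
  have hr1 : ∑ j, (inner ℂ (centeredVec b j) (σ (centeredVec b j))).re ≤ 1 := by
    have h1 : tr σ = 1 := by
      rw [tr, hσ.2, Complex.one_re]
    have h2 := hσ.1.re_inner_nonneg_right (e0 b)
    simp only [← tr_mul_ketbra]
    rw [← tr_sum, ← mul_sum, sum_ketbra_centeredVec b (by omega), centering, mul_sub, mul_one,
      tr_sub, tr_mul_ketbra, h1]
    simpa using h2
  by_cases hz : ∀ j, (inner ℂ (centeredVec b j) (σ (centeredVec b j))).re = 0 →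
      inner ℂ (centeredVec b j) ψ = 0
  · rw [dualForm_eq_coe_of_eq_zero_imp b hm hσ.1 hz, EReal.coe_le_coe_iff, _root_.smul_apply,
      inner_smul_right, Complex.re_ofReal_mul, inner_centering b (by omega), ← sum_div,
      div_mul_eq_mul_div]
    gcongr
    exact minEntropy_mul_sum_norm_sq_le (sum_inner_centeredVec b (by omega) ψ) hr hr1 hz
  · push Not at hz
    obtain ⟨j, hj, hne⟩ := hz
    have htop : dualForm (flatPyramid b hm) σ ψ = ⊤ := by
      rw [dualForm_flatPyramid, eq_top_iff]
      refine le_trans (le_of_eq ?_) (single_le_sum (fun i _ => mul_nonneg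
        (EReal.coe_nonneg.2 (sq_nonneg _)) (negLog_nonneg
          ((single_le_sum (fun i _ => hr i) (mem_univ i)).trans hr1))) (mem_univ j))
      rw [hj, negLog, if_pos le_rfl, EReal.coe_mul_top_of_pos]
      exact pow_pos (norm_pos_iff.2 hne) 2
    rw [htop]
    exact le_top

/-- For `σ = |v⟩⟨v|` and `ψ = v`, the dual form is exactly the entropy of the distribution `|⟨c_j,
v⟩|²`, in bits. -/
theorem inner_le_of_isDualFeasible [CompleteSpace H] (b : OrthonormalBasis (Fin m) ℂ H)
    (hm : 2 ≤ m) {Λ : H →L[ℂ] H} (hΛ : IsDualFeasible (flatPyramid b hm) Λ) {v : H}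
    (hv : HasMinEntropy b v) (hv1 : inner ℂ v v = 1) (hfix : centering b v = v) :
    (inner ℂ v (Λ v)).re ≤ minEntropy m / Real.log 2 := by
  have hsum : ∑ j, ‖inner ℂ (centeredVec b j) v‖ ^ 2 = 1 := by
    rw [← inner_centering b (by omega), hfix, hv1, Complex.one_re]
  have hpos : (ketbra v).IsPositive := isPositive_rankOne_self v
  have h := hΛ.2 (ketbra v) ⟨hpos, by rw [ketbra, trace_rankOne, hv1]⟩ v
  rw [dualForm_eq_coe_of_eq_zero_imp b hm hpos fun j hj => by
    rw [inner_ketbra_apply] at hj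
    simpa using hj, EReal.coe_le_coe_iff] at h
  refine h.trans (le_of_eq ?_)
  rw [HasMinEntropy, hsum] at hv
  simp only [inner_ketbra_apply, ← sum_div]
  simp only [div_one, mul_one] at hv
  rw [hv]

/-- Taking traces in `hsum` gives `w · card κ = m - 1`, so `ρ̄` is the uniform mixture of the states
`|v_k⟩⟨v_k|`, and averaging the bounds at the `v_k` gives the claim. -/
theorem tr_avgState_mul_le_of_sum_eq [CompleteSpace H] (b : OrthonormalBasis (Fin m) ℂ H)
    (hm : 2 ≤ m) {Λ : H →L[ℂ] H} (hΛ : IsDualFeasible (flatPyramid b hm) Λ) {v : κ → H} {w : ℝ}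
    (hw : 0 ≤ w) (hv : ∀ k, HasMinEntropy b (v k)) (hv1 : ∀ k, inner ℂ (v k) (v k) = 1)
    (hfix : ∀ k, centering b (v k) = v k)
    (hsum : (w : ℂ) • ∑ k, ketbra (v k) = centering b) :
    tr (avgState (flatPyramid b hm) * Λ) ≤ minEntropy m / Real.log 2 := by
  have h1 : (0 : ℝ) < m - 1 := by
    have : (2 : ℝ) ≤ m := by exact_mod_cast hm
    linarith
  have hnorm : ∀ k, ‖v k‖ ^ 2 = 1 := fun k => by
    have h := inner_self_eq_norm_sq (𝕜 := ℂ) (v k)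
    rw [hv1] at h
    simpa using h.symm
  have hcard : w * Fintype.card κ = m - 1 := by
    rw [← tr_centering b (by omega), ← hsum, tr_smul, tr_sum]
    simp [tr_ketbra, hnorm]
  have hle : ∑ k, tr (ketbra (v k) * Λ) ≤ Fintype.card κ * (minEntropy m / Real.log 2) := by
    rw [← nsmul_eq_mul, ← card_univ]
    refine sum_le_card_nsmul _ _ _ fun k _ => ?_
    rw [tr_ketbra_mul]
    exact inner_le_of_isDualFeasible b hm hΛ (hv k) (hv1 k) (hfix k)
  rw [avgState_flatPyramid, ← hsum, smul_mul_assoc, smul_mul_assoc, tr_smul, tr_smul, sum_mul,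
    tr_sum, one_div, inv_mul_le_iff₀ h1, ← hcard, mul_assoc]
  exact mul_le_mul_of_nonneg_left hle hw

theorem centering_pairVec (b : OrthonormalBasis (Fin m) ℂ H) (r s : Fin m) :
    centering b (pairVec b r s) = pairVec b r s := by
  have h : inner ℂ (e0 b) (pairVec b r s) = 0 := by
    rw [pairVec, inner_smul_right, inner_sub_right, inner_e0_basis, inner_e0_basis, sub_self,
      mul_zero]
  simp [centering, ketbra, h]

theorem inner_pairVec_self (b : OrthonormalBasis (Fin m) ℂ H) {r s : Fin m} (hrs : r ≠ s) :
    inner ℂ (pairVec b r s) (pairVec b r s) = 1 := by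
  have h : (1 / Real.sqrt 2 : ℝ) * (1 / Real.sqrt 2) * 2 = 1 := by
    have := Real.mul_self_sqrt zero_le_two
    field_simp
    linarith
  have h' := congrArg (fun x : ℝ => (x : ℂ)) h
  simp only [pairVec, inner_smul_left, inner_smul_right, inner_sub_left, inner_sub_right,
    OrthonormalBasis.inner_eq_ite, hrs, hrs.symm, if_true, if_false, Complex.conj_ofReal]
  push_cast at h' ⊢
  linear_combination h'

theorem hasMinEntropy_pyramidVec (b : OrthonormalBasis (Fin m) ℂ H) (hm : 7 ≤ m) (r : ℝ)
    (k : Fin m) : HasMinEntropy b (pyramidVec b 0 r k) :=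
  hasMinEntropy_add_e0 (by omega) ((hasMinEntropy_basis b hm k).smul _) _

theorem tr_avgState_mul_le [CompleteSpace H] (b : OrthonormalBasis (Fin m) ℂ H)
    (hm : 2 ≤ m) {Λ : H →L[ℂ] H} (hΛ : IsDualFeasible (flatPyramid b hm) Λ) :
    tr (avgState (flatPyramid b hm) * Λ) ≤ minEntropy m / Real.log 2 := by
  have hm' : (2 : ℝ) ≤ m := by exact_mod_cast hm
  have h1 : (0 : ℝ) < m - 1 := by linarith
  rcases le_or_gt m 6 with h6 | h7
  · refine tr_avgState_mul_le_of_sum_eq b hm hΛ (w := 2 / m)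
      (v := fun p : {p : Fin m × Fin m // p.1 < p.2} => pairVec b p.1.1 p.1.2) (by positivity)
      (fun p => hasMinEntropy_pairVec b h6 p.2.ne) (fun p => inner_pairVec_self b p.2.ne)
      (fun p => centering_pairVec b _ _) ?_
    rw [sum_ketbra_pair b (by omega), smul_smul, ← Complex.ofReal_mul,
      show (2 / m * (m / 2) : ℝ) = 1 by field_simp, Complex.ofReal_one, one_smul, centering]
  · refine tr_avgState_mul_le_of_sum_eq b hm hΛ (w := (m - 1) / m)
      (v := fun k => pyramidVec b 0 (1 / (m - 1)) k) (by positivity)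
      (fun k => hasMinEntropy_pyramidVec b h7 _ k)
      (fun k => inner_pyramidVec_self b (by omega) le_rfl (by positivity)
        (by rw [zero_add, mul_one_div_cancel h1.ne']) k)
      (fun k => by rw [pyramidVec_eq b (by omega), map_smul, centering_centeredVec b (by omega)])
      ?_
    simp only [pyramidVec_eq b (by omega : 1 ≤ m), ketbra_smul, ← smul_sum]
    rw [sum_ketbra_centeredVec b (by omega), smul_smul, ← Complex.ofReal_mul,
      Real.sq_sqrt (by positivity), show ((m - 1) / m * (m * (1 / (m - 1))) : ℝ) = 1 by field_simp,
      Complex.ofReal_one, one_smul]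

theorem tr_avgState_mul_centering (b : OrthonormalBasis (Fin m) ℂ H) (hm : 2 ≤ m) (c : ℝ) :
    tr (avgState (flatPyramid b hm) * ((c : ℂ) • centering b)) = c := by
  have h1 : (m : ℝ) - 1 ≠ 0 := by
    have : (2 : ℝ) ≤ m := by exact_mod_cast hm
    linarith
  rw [avgState_flatPyramid, smul_mul_smul_comm, (isIdempotentElem_centering b (by omega)).eq,
    ← Complex.ofReal_mul, tr_smul, tr_centering b (by omega)]
  field_simp

theorem isDualSolution_centering [CompleteSpace H] (b : OrthonormalBasis (Fin m) ℂ H)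
    (hm : 2 ≤ m) :
    IsDualSolution (flatPyramid b hm)
      (((minEntropy m / Real.log 2 : ℝ) : ℂ) • centering b) :=
  ⟨isDualFeasible_centering b hm, fun Λ hΛ => by
    rw [tr_avgState_mul_centering]
    exact tr_avgState_mul_le b hm hΛ⟩

theorem tr_avgState_mul_eq_of_isDualSolution [CompleteSpace H]
    (b : OrthonormalBasis (Fin m) ℂ H) (hm : 2 ≤ m) {Λ : H →L[ℂ] H}
    (hΛ : IsDualSolution (flatPyramid b hm) Λ) :
    tr (avgState (flatPyramid b hm) * Λ) = minEntropy m / Real.log 2 := by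
  refine le_antisymm (tr_avgState_mul_le b hm hΛ.1) ?_
  have h := hΛ.2 _ (isDualFeasible_centering b hm)
  rwa [tr_avgState_mul_centering] at h

/-! ### The optimal value and the main theorem -/

theorem accessibleInfo_flatPyramid (b : OrthonormalBasis (Fin m) ℂ H) (hm : 2 ≤ m) :
    accessibleInfo (flatPyramid b hm) = Real.logb 2 m - minEntropy m / Real.log 2 := by
  rcases le_or_gt m 6 with h6 | h7
  · exact accessibleInfo_flatPyramid_eq b hm _ (mutualInfo_pyramidObservableTop b hm h6)
  · exact accessibleInfo_flatPyramid_eq b hm _ (mutualInfo_pyramidObservable_one b h7)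

theorem logb_sub_minEntropy (hm : 2 ≤ m) :
    Real.logb 2 m - minEntropy m / Real.log 2 = if m ≤ 6 then Real.logb 2 ((m : ℝ) / 2)
      else ((m : ℝ) - 2) / m * Real.logb 2 ((m : ℝ) - 1) := by
  have hlog : Real.log 2 ≠ 0 := (Real.log_pos one_lt_two).ne'
  have hm0 : (m : ℝ) ≠ 0 := by exact_mod_cast (by omega : m ≠ 0)
  rw [minEntropy]
  split_ifs with h
  · rw [Real.logb, Real.logb, Real.log_div hm0 two_ne_zero, sub_div]
  · rw [Real.logb, Real.logb]
    ring

end QInfo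

theorem corollary3 {H : Type*} [NormedAddCommGroup H] [InnerProductSpace ℂ H]
    [FiniteDimensional ℂ H] [CompleteSpace H] {m : ℕ} (hm : 2 ≤ m)
    (b : OrthonormalBasis (Fin m) ℂ H) :
    (7 ≤ m →
      QInfo.IsInfoOptimal (QInfo.flatPyramid b hm)
        (QInfo.pyramidObservable b (one_le_two.trans hm) 1 le_rfl)) ∧
    (m ≤ 6 →
      QInfo.IsInfoOptimal (QInfo.flatPyramid b hm)
        (QInfo.pyramidObservableTop b (one_le_two.trans hm))) ∧
    (∃ Λ₀ : H →L[ℂ] H, QInfo.IsDualSolution (QInfo.flatPyramid b hm) Λ₀) ∧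
    (∀ Λ₀ : H →L[ℂ] H, QInfo.IsDualSolution (QInfo.flatPyramid b hm) Λ₀ →
      QInfo.accessibleInfo (QInfo.flatPyramid b hm) =
        Real.logb 2 m - QInfo.tr (Λ₀ * QInfo.avgState (QInfo.flatPyramid b hm))) ∧
    QInfo.accessibleInfo (QInfo.flatPyramid b hm) =
      if m ≤ 6 then Real.logb 2 ((m : ℝ) / 2)
      else ((m : ℝ) - 2) / m * Real.logb 2 ((m : ℝ) - 1) := by
  refine ⟨fun h7 n N => ?_, fun h6 n N => ?_, ⟨_, QInfo.isDualSolution_centering b hm⟩,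
    fun Λ₀ hΛ₀ => ?_, ?_⟩
  · rw [QInfo.mutualInfo_pyramidObservable_one b h7]
    exact QInfo.mutualInfo_flatPyramid_le b hm N
  · rw [QInfo.mutualInfo_pyramidObservableTop b hm h6]
    exact QInfo.mutualInfo_flatPyramid_le b hm N
  · rw [QInfo.accessibleInfo_flatPyramid, QInfo.tr_mul_comm,
      QInfo.tr_avgState_mul_eq_of_isDualSolution b hm hΛ₀]
  · rw [QInfo.accessibleInfo_flatPyramid, QInfo.logb_sub_minEntropy hm]
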